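/- **Proposition 3.4.** Let $Q\subset\mathbb R^N$ be an open non-degenerate parallelogram (parallelepiped), let $\Omega\subset\mathbb R^N$ be open with $Q\subset\Omega$, and let $p,q>1$, $\frac1p+\frac1{p'}=1$, $\frac1q+\frac1{q'}=1$. Let $L:\Omega\times\mathbb R^N\times\mathbb R^N\to\mathbb R$ be measurable with respect to the $\sigma$-field generated by the products of Lebesgue sets in $\Omega$ and Borel sets in $\mathbb R^N\times\mathbb R^N$, let $L(x,\cdot,\cdot)$ be convex for a.e. $x\in\Omega$, and suppose that for some constants $C_0,C_1>0$ and functions $n_0,n_1\in L^1(\Omega)$, for a.e. $x\in\Omega$, $$C_0\big(|a|^p+|b|^q-n_0(x)\big)\le L(x,a,b)\le C_1\big(|a|^p+|b|^q+n_1(x)\big)\qquad\text{for all }a,b\in\mathbb R^N .$$ For $1<r<\infty$ let $W^{1,r}_\#(Q)$ be the space of $Q$-periodic functions $\varphi\in W^{1,r}_{loc}(\mathbb R^N)$ with $\int_Q\varphi\,dx=0$, and, with $r'=\frac r{r-1}$, let $$L^r_\#(Q;\mathbb R^N)=\Big\{g\in L^r(Q;\mathbb R^N):\ \int_Q g\,dx=0,\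 \int_Q\langle g,\nabla\varphi\rangle\,dx=0\ \text{ for all }\varphi\in W^{1,r'}_\#(Q)\Big\}.$$ Put $$L_{hom}(a,b)=\min_{\varphi\in W^{1,p}_\#(Q),\ g\in L^q_\#(Q;\mathbb R^N)}\ \frac1{|Q|}\int_Q L\big(x,a+\nabla\varphi(x),b+g(x)\big)\,dx ,$$ and let $L^*(x,\cdot,\cdot)$ and $L_{hom}^*$ be the Fenchel–Legendre conjugates in both vector variables, $F^*(a^*,b^*)=\sup_{a,b}\{\langle a,a^*\rangle+\langle b,b^*\rangle-F(a,b)\}$. Then the integrals over $Q$ in these cell formulas are those of integrable functions, $L^*(x,\cdot,\cdot)$ (for a.e. $x\in Q$) and $L_{hom}^*$ are finite, the minimum defining $L_{hom}$ is attained, and: 1. $L_{hom}$ is convex and lower semicontinuous on $\mathbb R^N\times\mathbb R^N$. 2. For all $a^*,b^*\in\mathbb R^N$, $$L_{hom}^*(a^*,b^*)=\inf_{\varphi\in W^{1,q'}_\#(Q),\ g\in L^{p'}_\#(Q;\mathbb R^N)}\ \frac1{|Q|}\int_Q L^*\big(x,a^*+g(x),b^*+\nabla\varphi(x)\big)\,dx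 .$$ 3. For all $a,b\in\mathbb R^N$, $$C_0\Big(|a|^p+|b|^q-\frac1{|Q|}\int_Q n_0\,dx\Big)\le L_{hom}(a,b)\le C_1\Big(|a|^p+|b|^q+\frac1{|Q|}\int_Q n_1\,dx\Big);$$ in particular, if $n_0=n_1=1$ on $Q$, then $C_0(|a|^p+|b|^q-1)\le L_{hom}(a,b)\le C_1(1+|a|^p+|b|^q)$. -/

import Mathlib

open MeasureTheory Set
open scoped ContDiff

namespace PeriodicCell

/-- `ℝ^N` with its Euclidean norm and inner product. -/
abbrev Vec (N : ℕ) : Type := EuclideanSpace ℝ (Fin N)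

variable {N : ℕ}

/-- The open non-degenerate parallelogram (parallelepiped) with corner `x₀` and edges `v i`:
the points `x₀ + ∑ i, t i • v i` with `0 < t i < 1`.  Non-degeneracy: `v` is a basis. -/
def cell (x₀ : Vec N) (v : Module.Basis (Fin N) ℝ (Vec N)) : Set (Vec N) :=
  {x | ∀ i, v.repr (x - x₀) i ∈ Ioo (0 : ℝ) 1}

/-- `G` is the weak gradient of `φ` on the whole space (both are meant to be locally integrable):
`∫ φ ∂ᵢψ = - ∫ Gᵢ ψ` for all test functions `ψ ∈ C_c^∞(ℝ^N)` and all `i`. -/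
def IsWeakGradient (φ : Vec N → ℝ) (G : Vec N → Vec N) : Prop :=
  ∀ ψ : Vec N → ℝ, ContDiff ℝ ∞ ψ → HasCompactSupport ψ → ∀ i : Fin N,
    ∫ x, φ x * fderiv ℝ ψ x (EuclideanSpace.single i 1) = - ∫ x, G x i * ψ x

/-- `φ ∈ W^{1,r}_#(Q)` with `∇φ = G`, where `Q = cell x₀ v`.  The functions are given by their
`Q`-periodic extensions to `ℝ^N`; that the extension is weakly differentiable across the faces of
the translates of `Q` is the equality of the traces of `φ` on opposite faces of `Q`. -/
structure IsPeriodicSobolev (x₀ : Vec N) (v : Module.Basis (Fin N) ℝ (Vec N)) (r : ℝ)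
    (φ : Vec N → ℝ) (G : Vec N → Vec N) : Prop where
  periodic : ∀ i x, φ (x + v i) = φ x
  periodic_grad : ∀ i x, G (x + v i) = G x
  memLp : MemLp φ (ENNReal.ofReal r) (volume.restrict (cell x₀ v))
  memLp_grad : MemLp G (ENNReal.ofReal r) (volume.restrict (cell x₀ v))
  weakGradient : IsWeakGradient φ G
  mean_zero : ∫ x in cell x₀ v, φ x = 0

/-- `g ∈ L^s_#(Q; ℝ^N)`: the fields in `L^s(Q; ℝ^N)` with mean zero that are orthogonal to the
gradient of every function in `W^{1,s'}_#(Q)`, where `s' = s / (s - 1)` is the conjugate exponent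
(for `1 < s < ∞`). -/
structure IsPeriodicSolenoidal (x₀ : Vec N) (v : Module.Basis (Fin N) ℝ (Vec N)) (s : ℝ)
    (g : Vec N → Vec N) : Prop where
  memLp : MemLp g (ENNReal.ofReal s) (volume.restrict (cell x₀ v))
  mean_zero : ∫ x in cell x₀ v, g x = 0
  orthogonal : ∀ (φ : Vec N → ℝ) (G : Vec N → Vec N),
    IsPeriodicSobolev x₀ v (s / (s - 1)) φ G → ∫ x in cell x₀ v, inner ℝ (g x) (G x) = 0

/-- `L : Ω × ℝ^N × ℝ^N → ℝ` is measurable with respect to the `σ`-field generated by the products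
of Lebesgue sets in `Ω` and Borel sets in `ℝ^N × ℝ^N` (values of `L` off `Ω` play no role;
`NullMeasurableSpace` carries the Lebesgue `σ`-field). -/
def LebesgueBorelMeasurableOn (Ω : Set (Vec N)) (L : Vec N → Vec N → Vec N → ℝ) : Prop :=
  Measurable (fun z : NullMeasurableSpace (Vec N) volume × (Vec N × Vec N) =>
    Ω.indicator (fun x : Vec N => L x z.2.1 z.2.2) z.1)

/-- An `Ω`-dependent Lagrangian with finite values: jointly measurable, and convex in the last two
variables for almost every `x ∈ Ω` (lower semicontinuity in these variables is then automatic). -/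
structure IsLagrangian (Ω : Set (Vec N)) (L : Vec N → Vec N → Vec N → ℝ) : Prop where
  measurable : LebesgueBorelMeasurableOn Ω L
  convex : ∀ᵐ x ∂(volume.restrict Ω),
    ConvexOn ℝ univ (fun z : Vec N × Vec N => L x z.1 z.2)

/-- The numbers of which the Fenchel-Legendre conjugate of `F` at `(a', b')` is the supremum. -/
def conjValues (F : Vec N → Vec N → ℝ) (a' b' : Vec N) : Set ℝ :=
  range fun z : Vec N × Vec N => inner ℝ z.1 a' + inner ℝ z.2 b' - F z.1 z.2

/-- Fenchel-Legendre conjugate in both variables,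
`F^*(a', b') = sup_{a, b} ⟨a, a'⟩ + ⟨b, b'⟩ - F(a, b)`. -/
noncomputable def conj (F : Vec N → Vec N → ℝ) (a' b' : Vec N) : ℝ :=
  sSup (conjValues F a' b')

/-- The averages `|Q|⁻¹ ∫_Q L(x, a + ∇φ(x), b + g(x)) dx` with `φ ∈ W^{1,p}_#(Q)` and
`g ∈ L^q_#(Q; ℝ^N)`. -/
def cellValues (x₀ : Vec N) (v : Module.Basis (Fin N) ℝ (Vec N)) (p q : ℝ)
    (L : Vec N → Vec N → Vec N → ℝ) (a b : Vec N) : Set ℝ :=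
  {t | ∃ (φ : Vec N → ℝ) (G g : Vec N → Vec N),
    IsPeriodicSobolev x₀ v p φ G ∧ IsPeriodicSolenoidal x₀ v q g ∧
      t = ⨍ x in cell x₀ v, L x (a + G x) (b + g x)}

/-- The homogenized Lagrangian `L_hom`. -/
noncomputable def homLagrangian (x₀ : Vec N) (v : Module.Basis (Fin N) ℝ (Vec N)) (p q : ℝ)
    (L : Vec N → Vec N → Vec N → ℝ) (a b : Vec N) : ℝ :=
  sInf (cellValues x₀ v p q L a b)

/-- The averages `|Q|⁻¹ ∫_Q L^*(x, a' + g(x), b' + ∇φ(x)) dx` with `φ ∈ W^{1,q'}_#(Q)` and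
`g ∈ L^{p'}_#(Q; ℝ^N)`, the conjugate `L^*(x, ·, ·)` being taken for each fixed `x`. -/
def dualCellValues (x₀ : Vec N) (v : Module.Basis (Fin N) ℝ (Vec N)) (p' q' : ℝ)
    (L : Vec N → Vec N → Vec N → ℝ) (a' b' : Vec N) : Set ℝ :=
  {t | ∃ (φ : Vec N → ℝ) (G g : Vec N → Vec N),
    IsPeriodicSobolev x₀ v q' φ G ∧ IsPeriodicSolenoidal x₀ v p' g ∧
      t = ⨍ x in cell x₀ v, conj (L x) (a' + g x) (b' + G x)}

end PeriodicCell

/-! The proof is convex duality between two orthogonal decompositions. If `φ` is periodic and `h` is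
periodic solenoidal with conjugate exponents, then `⟨a' + h, a + ∇φ⟩` integrates over the cell to
`|Q|⟨a', a⟩`, because periodic gradients and solenoidal fields have mean zero and are orthogonal.
Integrating the Fenchel-Young inequality for `L(x,·,·)` therefore gives weak duality
(`inner_add_inner_le_average`): `⟨a,a'⟩ + ⟨b,b'⟩` is at most a primal average plus a dual average.

Equality comes from one abstract result, `IsGrowthIntegrand.exists_dual`. A linear functional on a
subspace `W` of `L^p × L^q` that is dominated there by a finite continuous convex integral
functional plus a constant extends, by Hahn-Banach, to a functional on the whole space with the same
domination. Riesz representation turns the extension into fields `(ξ, η)`, and a measurable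
selection shows that the conjugate of the integral functional dominates the integral of the
conjugate integrand.

With `W` = (constants + gradients) × (constants + solenoidal fields) and the pairing with the
constants `(a', b')`, the extension satisfies: `ξ - a'` annihilates constants and gradients, so it
is solenoidal; `η - b'` annihilates constants and solenoidal fields, so it is a gradient. The second
inference needs the space of periodic gradients to be closed in `L^r`, which follows from the
Poincaré inequality. This gives the formula for the conjugate of `L_hom`, with the infimum attained.
The same argument applied to `L^*`, together with `L^** = L`, produces minimizers of the primal cell
problem, so no weak compactness is used.

Convexity of `L_hom` follows by combining minimizers, semicontinuity from finiteness and convexity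
in finite dimension, and the growth bounds from Jensen's inequality (below) and the zero competitor
(above). -/

/-! ### Uniform convexity of `L^p` and Riesz representation. -/

section Riesz

open Filter Topology

/-- Quantitative strict convexity of `‖·‖ ^ p` on a finite-dimensional inner product space. -/
theorem exists_norm_sub_rpow_le {E : Type*} [NormedAddCommGroup E] [InnerProductSpace ℝ E]
    [FiniteDimensional ℝ E] {p : ℝ} (hp : 1 < p) {ε : ℝ} (hε : 0 < ε) :
    ∃ C : ℝ, 0 ≤ C ∧ ∀ a b : E, ‖a - b‖ ^ p ≤ ε * (‖a‖ ^ p + ‖b‖ ^ p) +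
      C * ((‖a‖ ^ p + ‖b‖ ^ p) / 2 - ‖(1 / 2 : ℝ) • (a + b)‖ ^ p) := by
  have hp0 : 0 < p := by linarith
  have hcont : Continuous fun x : E => ‖x‖ ^ p :=
    continuous_norm.rpow_const fun _ => Or.inr hp0.le
  set D : E × E → ℝ := fun z => (‖z.1‖ ^ p + ‖z.2‖ ^ p) / 2 - ‖(1 / 2 : ℝ) • (z.1 + z.2)‖ ^ p
  have hD : Continuous D := by
    have h1 := hcont.comp (continuous_fst (X := E) (Y := E))
    have h2 := hcont.comp (continuous_snd (X := E) (Y := E))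
    have h3 : Continuous fun z : E × E => ‖(1 / 2 : ℝ) • (z.1 + z.2)‖ ^ p :=
      hcont.comp (by fun_prop)
    exact ((h1.add h2).div_const 2).sub h3
  -- For equal norms the strictness comes from the inner product norm, for different norms from
  -- strict convexity of `t ^ p`.
  have hpos : ∀ a b : E, a ≠ b → 0 < D (a, b) := by
    intro a b hab
    have htri : ‖(1 / 2 : ℝ) • (a + b)‖ ≤ (‖a‖ + ‖b‖) / 2 := by
      rw [norm_smul]
      have := norm_add_le a b
      norm_num
      linarith
    by_cases hn : ‖a‖ = ‖b‖
    · have h := (norm_midpoint_lt_iff hn).2 hab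
      have h' := Real.rpow_lt_rpow (norm_nonneg _) h hp0
      simp only [D, ← hn]
      linarith
    · have h := (strictConvexOn_rpow hp).2 (norm_nonneg a) (norm_nonneg b) hn
        (by norm_num : (0 : ℝ) < 1 / 2) (by norm_num : (0 : ℝ) < 1 / 2) (by norm_num)
      have h' := Real.rpow_le_rpow (norm_nonneg _) htri hp0.le
      simp only [smul_eq_mul] at h
      have e : 1 / 2 * ‖a‖ + 1 / 2 * ‖b‖ = (‖a‖ + ‖b‖) / 2 := by ring
      rw [e] at h
      simp only [D]
      linarith
  have hnonneg : ∀ z : E × E, 0 ≤ D z := by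
    rintro ⟨a, b⟩
    by_cases hab : a = b
    · subst hab
      have : (1 / 2 : ℝ) • (a + a) = a := by
        rw [← two_smul ℝ, smul_smul]; norm_num
      simp only [D, this]
      linarith
    · exact (hpos a b hab).le
  -- Both sides are homogeneous of degree `p`, so it suffices to treat the normalized pairs. Those
  -- not already covered by the `ε` term form a compact set avoiding the diagonal, on which `D` is
  -- positive and the quotient is bounded.
  set K : Set (E × E) := {z | ‖z.1‖ ^ p + ‖z.2‖ ^ p = 1 ∧ ε ≤ ‖z.1 - z.2‖ ^ p}
  have hsum : Continuous fun z : E × E => ‖z.1‖ ^ p + ‖z.2‖ ^ p :=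
    (hcont.comp continuous_fst).add (hcont.comp continuous_snd)
  have hKc : IsClosed K :=
    (isClosed_eq hsum continuous_const).inter
      (isClosed_le continuous_const (hcont.comp (continuous_fst.sub continuous_snd)))
  have hKb : K ⊆ Metric.closedBall 0 1 := by
    rintro ⟨a, b⟩ ⟨h1, -⟩
    have ha : ‖a‖ ^ p ≤ 1 := by
      have := Real.rpow_nonneg (norm_nonneg b) p
      simp only at h1; linarith
    have hb : ‖b‖ ^ p ≤ 1 := by
      have := Real.rpow_nonneg (norm_nonneg a) p
      simp only at h1; linarith
    rw [mem_closedBall_zero_iff, Prod.norm_def, sup_le_iff]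
    constructor
    · by_contra! h
      exact absurd ha (not_le.2 (Real.one_lt_rpow h hp0))
    · by_contra! h
      exact absurd hb (not_le.2 (Real.one_lt_rpow h hp0))
  have hKcomp : IsCompact K := (isCompact_closedBall _ _).of_isClosed_subset hKc hKb
  obtain ⟨C, hC0, hC⟩ : ∃ C : ℝ, 0 ≤ C ∧ ∀ z ∈ K, ‖z.1 - z.2‖ ^ p ≤ C * D z := by
    have hratio : ContinuousOn (fun z : E × E => ‖z.1 - z.2‖ ^ p / D z) K := by
      refine ContinuousOn.div (hcont.comp (continuous_fst.sub continuous_snd)).continuousOn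
        hD.continuousOn ?_
      rintro ⟨a, b⟩ ⟨-, h2⟩
      refine (hpos a b ?_).ne'
      rintro rfl
      simp only [sub_self, norm_zero, Real.zero_rpow hp0.ne'] at h2
      linarith
    obtain ⟨C, hC⟩ := (hKcomp.image_of_continuousOn hratio).bddAbove
    refine ⟨max C 0, le_max_right _ _, ?_⟩
    rintro ⟨a, b⟩ hz
    have hne : a ≠ b := by
      rintro rfl
      have := hz.2
      simp only [sub_self, norm_zero, Real.zero_rpow hp0.ne'] at this
      linarith
    have := hC (mem_image_of_mem _ hz)
    have h2 : ‖a - b‖ ^ p / D (a, b) ≤ max C 0 := this.trans (le_max_left _ _)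
    rwa [div_le_iff₀ (hpos a b hne)] at h2
  refine ⟨C, hC0, fun a b => ?_⟩
  set s : ℝ := ‖a‖ ^ p + ‖b‖ ^ p with hs
  have hs0 : 0 ≤ s := add_nonneg (Real.rpow_nonneg (norm_nonneg _) _)
    (Real.rpow_nonneg (norm_nonneg _) _)
  have hCD : 0 ≤ C * D (a, b) := mul_nonneg hC0 (hnonneg _)
  by_cases hlt : ‖a - b‖ ^ p < ε * s
  · have : ‖a - b‖ ^ p ≤ ε * s + C * D (a, b) := by linarith
    exact this
  push Not at hlt
  rcases hs0.eq_or_lt with h0 | h0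
  · have ha : ‖a‖ ^ p = 0 := by
      have := Real.rpow_nonneg (norm_nonneg b) p
      have := Real.rpow_nonneg (norm_nonneg a) p
      linarith
    have hb : ‖b‖ ^ p = 0 := by linarith
    rw [Real.rpow_eq_zero (norm_nonneg _) hp0.ne', norm_eq_zero] at ha hb
    subst ha hb
    simp [hs, Real.zero_rpow hp0.ne']
  · set t : ℝ := (s ^ (1 / p))⁻¹ with ht
    have htp : 0 < t := inv_pos.2 (Real.rpow_pos_of_pos h0 _)
    have htpow : t ^ p = s⁻¹ := by
      rw [ht, Real.inv_rpow (Real.rpow_nonneg hs0 _), ← Real.rpow_mul hs0,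
        one_div_mul_cancel hp0.ne', Real.rpow_one]
    have hscale : ∀ x : E, ‖t • x‖ ^ p = s⁻¹ * ‖x‖ ^ p := by
      intro x
      rw [norm_smul, Real.mul_rpow (norm_nonneg _) (norm_nonneg _), Real.norm_of_nonneg htp.le,
        htpow]
    have hmem : (t • a, t • b) ∈ K := by
      constructor
      · simp only [hscale]
        rw [← mul_add, ← hs, inv_mul_cancel₀ h0.ne']
      · simp only [← smul_sub, hscale]
        rw [inv_mul_eq_div, le_div_iff₀ h0]
        exact hlt
    have h := hC _ hmem
    have hDs : D (t • a, t • b) = s⁻¹ * D (a, b) := by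
      simp only [D, ← smul_add, smul_comm (1 / 2 : ℝ) t, hscale]
      ring
    simp only [← smul_sub, hscale] at h
    rw [hDs] at h
    have h3 : ‖a - b‖ ^ p ≤ C * D (a, b) := by
      have hsi : 0 < s⁻¹ := inv_pos.2 h0
      refine le_of_mul_le_mul_left ?_ hsi
      calc s⁻¹ * ‖a - b‖ ^ p ≤ C * (s⁻¹ * D (a, b)) := h
        _ = s⁻¹ * (C * D (a, b)) := by ring
    have h4 : 0 ≤ ε * s := by positivity
    have : ‖a - b‖ ^ p ≤ ε * s + C * D (a, b) := by linarith
    exact this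

/-- In a complete space whose norm satisfies a power-type uniform convexity estimate, the
functionals `‖u‖ ^ p / p - ℓ u` attain their minimum. -/
theorem exists_forall_norm_rpow_sub_le {X : Type*} [NormedAddCommGroup X] [NormedSpace ℝ X]
    [CompleteSpace X] {p : ℝ} (hp : 1 < p)
    (huc : ∀ ε : ℝ, 0 < ε → ∃ C : ℝ, 0 ≤ C ∧ ∀ u v : X,
      ‖u - v‖ ^ p ≤ ε * (‖u‖ ^ p + ‖v‖ ^ p) +
        C * ((‖u‖ ^ p + ‖v‖ ^ p) / 2 - ‖(1 / 2 : ℝ) • (u + v)‖ ^ p))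
    (ℓ : X →L[ℝ] ℝ) :
    ∃ u : X, ∀ v : X, ‖u‖ ^ p / p - ℓ u ≤ ‖v‖ ^ p / p - ℓ v := by
  have hp0 : 0 < p := by linarith
  set J : X → ℝ := fun u => ‖u‖ ^ p / p - ℓ u
  have hJc : Continuous J :=
    ((continuous_norm.rpow_const fun _ => Or.inr hp0.le).div_const p).sub ℓ.continuous
  -- Coercivity: Young's inequality with factors `‖u‖ / 2` and `2 * ‖ℓ‖` costs at most half of the
  -- leading term.
  obtain ⟨B, hB⟩ : ∃ B : ℝ, ∀ u, ‖u‖ ^ p / (2 * p) - B ≤ J u := by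
    have hconj := Real.HolderConjugate.conjExponent hp
    refine ⟨(2 * ‖ℓ‖) ^ p.conjExponent / p.conjExponent, fun u => ?_⟩
    have h1 : ℓ u ≤ ‖ℓ‖ * ‖u‖ := (le_abs_self _).trans (ℓ.le_opNorm u)
    have h2 := Real.young_inequality_of_nonneg (a := ‖u‖ / 2) (b := 2 * ‖ℓ‖) (by positivity)
      (by positivity) hconj
    have h3 : (‖u‖ / 2) ^ p ≤ ‖u‖ ^ p / 2 := by
      rw [Real.div_rpow (norm_nonneg _) (by norm_num)]
      refine div_le_div_of_nonneg_left (by positivity) (by norm_num) ?_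
      calc (2 : ℝ) = 2 ^ (1 : ℝ) := by norm_num
        _ ≤ 2 ^ p := Real.rpow_le_rpow_of_exponent_le (by norm_num) hp.le
    have h4 : (‖u‖ / 2) ^ p / p ≤ ‖u‖ ^ p / (2 * p) := by
      rw [mul_comm 2 p, ← div_div, div_right_comm]
      exact div_le_div_of_nonneg_right h3 hp0.le
    have h5 : ‖u‖ ^ p / p = 2 * (‖u‖ ^ p / (2 * p)) := by field_simp
    have h6 : ‖u‖ / 2 * (2 * ‖ℓ‖) = ‖ℓ‖ * ‖u‖ := by ring
    simp only [J]
    rw [h5]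
    linarith
  have hbdd : BddBelow (range J) := by
    refine ⟨-B, ?_⟩
    rintro _ ⟨u, rfl⟩
    have := hB u
    have : 0 ≤ ‖u‖ ^ p / (2 * p) := by positivity
    linarith
  set m := sInf (range J)
  have hm : ∀ u, m ≤ J u := fun u => csInf_le hbdd ⟨u, rfl⟩
  have hex : ∀ n : ℕ, ∃ u, J u < m + 1 / (n + 1) := by
    intro n
    obtain ⟨_, ⟨u, rfl⟩, hu⟩ := exists_lt_of_csInf_lt (range_nonempty J)
      (lt_add_of_pos_right m (Nat.one_div_pos_of_nat (α := ℝ) (n := n)))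
    exact ⟨u, hu⟩
  choose u hu using hex
  have hR : ∀ n, ‖u n‖ ^ p ≤ 2 * p * (m + 1 + B) := by
    intro n
    have h1 := hB (u n)
    have h2 := hu n
    have h3 : (1 : ℝ) / (n + 1) ≤ 1 := by
      rw [div_le_one (by positivity)]
      linarith [(Nat.cast_nonneg n : (0 : ℝ) ≤ n)]
    have h4 : ‖u n‖ ^ p / (2 * p) ≤ m + 1 + B := by linarith
    rwa [div_le_iff₀ (by positivity), mul_comm] at h4
  set R := 2 * p * (m + 1 + B)
  have hR0 : 0 ≤ R := (Real.rpow_nonneg (norm_nonneg _) _).trans (hR 0)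
  -- The linear part of `J` cancels in the midpoint defect, so near-minimality of the two points
  -- bounds the defect of `‖·‖ ^ p`.
  have hmid : ∀ n k, (‖u n‖ ^ p + ‖u k‖ ^ p) / 2 - ‖(1 / 2 : ℝ) • (u n + u k)‖ ^ p ≤
      p * (1 / (n + 1) + 1 / (k + 1)) := by
    intro n k
    have h0 := hm ((1 / 2 : ℝ) • (u n + u k))
    have h1 := hu n
    have h2 := hu k
    simp only [J, map_smul, map_add, smul_eq_mul] at h0 h1 h2
    have h3 : (‖u n‖ ^ p + ‖u k‖ ^ p) / 2 - ‖(1 / 2 : ℝ) • (u n + u k)‖ ^ p =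
      p * ((‖u n‖ ^ p / p + ‖u k‖ ^ p / p) / 2 - ‖(1 / 2 : ℝ) • (u n + u k)‖ ^ p / p) := by
      field_simp
    rw [h3]
    refine mul_le_mul_of_nonneg_left ?_ hp0.le
    have h4 : (0 : ℝ) < 1 / (n + 1) := Nat.one_div_pos_of_nat
    have h5 : (0 : ℝ) < 1 / (k + 1) := Nat.one_div_pos_of_nat
    linarith
  have hcau : CauchySeq u := by
    rw [Metric.cauchySeq_iff']
    intro e he
    have hep : 0 < e ^ p := Real.rpow_pos_of_pos he p
    -- The small parameter is chosen so that the bound `R` on the sequence leaves less than `e ^ p /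
    -- 2`; the index `M` then makes the defect term at most `e ^ p / 2`.
    obtain ⟨C, hC0, hC⟩ := huc (e ^ p / (4 * (R + 1))) (by positivity)
    obtain ⟨M, hM⟩ := exists_nat_one_div_lt (K := ℝ)
      (show (0 : ℝ) < e ^ p / (4 * (p * (C + 1))) by positivity)
    refine ⟨M, fun n hn => ?_⟩
    rw [dist_eq_norm]
    have h1 := hC (u n) (u M)
    have h2 := hmid n M
    have h3 : (1 : ℝ) / (n + 1) ≤ 1 / (M + 1) := Nat.one_div_le_one_div hn
    have h4 : C * ((‖u n‖ ^ p + ‖u M‖ ^ p) / 2 - ‖(1 / 2 : ℝ) • (u n + u M)‖ ^ p) ≤ e ^ p / 2 := by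
      calc _ ≤ C * (p * (1 / (n + 1) + 1 / (M + 1))) := mul_le_mul_of_nonneg_left h2 hC0
        _ ≤ C * (p * (2 * (e ^ p / (4 * (p * (C + 1)))))) := by
            refine mul_le_mul_of_nonneg_left (mul_le_mul_of_nonneg_left ?_ hp0.le) hC0
            linarith
        _ = (C / (C + 1)) * (e ^ p / 2) := by field_simp; ring
        _ ≤ 1 * (e ^ p / 2) := by
            refine mul_le_mul_of_nonneg_right ?_ (by positivity)
            rw [div_le_one (by positivity)]; linarith
        _ = e ^ p / 2 := one_mul _
    have h5 : e ^ p / (4 * (R + 1)) * (‖u n‖ ^ p + ‖u M‖ ^ p) < e ^ p / 2 := by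
      calc _ ≤ e ^ p / (4 * (R + 1)) * (R + R) :=
            mul_le_mul_of_nonneg_left (add_le_add (hR n) (hR M)) (by positivity)
        _ = (R / (R + 1)) * (e ^ p / 2) := by field_simp; ring
        _ < 1 * (e ^ p / 2) := by
            refine mul_lt_mul_of_pos_right ?_ (by positivity)
            rw [div_lt_one (by positivity)]; linarith
        _ = e ^ p / 2 := one_mul _
    exact (Real.rpow_lt_rpow_iff (norm_nonneg _) he.le hp0).1 (by linarith)
  obtain ⟨w, hw⟩ := cauchySeq_tendsto_of_complete hcau
  refine ⟨w, fun v => ?_⟩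
  refine le_trans ?_ (hm v)
  refine le_of_tendsto_of_tendsto ((hJc.tendsto w).comp hw)
    (?_ : Tendsto (fun n : ℕ => m + 1 / ((n : ℝ) + 1)) atTop (𝓝 m))
    (Eventually.of_forall fun n => (hu n).le)
  simpa using tendsto_const_nhds.add (tendsto_one_div_add_atTop_nhds_zero_nat (𝕜 := ℝ))

variable {α E : Type*} [MeasurableSpace α] {μ : Measure α} [NormedAddCommGroup E]

theorem memLp_ofReal_iff {p : ℝ} (hp : 0 < p) {f : α → E} (hf : AEStronglyMeasurable f μ) :
    MemLp f (ENNReal.ofReal p) μ ↔ Integrable (fun x => ‖f x‖ ^ p) μ := by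
  have h := integrable_norm_rpow_iff (p := ENNReal.ofReal p) hf (by simpa using hp)
    ENNReal.ofReal_ne_top
  rw [ENNReal.toReal_ofReal hp.le] at h
  exact h.symm

theorem MeasureTheory.MemLp.integrable_rpow_ofReal {p : ℝ} (hp : 0 < p) {f : α → E}
    (hf : MemLp f (ENNReal.ofReal p) μ) : Integrable (fun x => ‖f x‖ ^ p) μ :=
  (memLp_ofReal_iff hp hf.1).1 hf

theorem MeasureTheory.Lp.norm_rpow_eq_integral {p : ℝ} (hp : 0 < p)
    (u : Lp E (ENNReal.ofReal p) μ) : ‖u‖ ^ p = ∫ x, ‖u x‖ ^ p ∂μ := by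
  have h0 : 0 ≤ ∫ x, ‖u x‖ ^ p ∂μ := integral_nonneg fun x => Real.rpow_nonneg (norm_nonneg _) _
  rw [Lp.norm_def, (Lp.memLp u).eLpNorm_eq_integral_rpow_norm (by simpa using hp)
    ENNReal.ofReal_ne_top, ENNReal.toReal_ofReal hp.le,
    ENNReal.toReal_ofReal (Real.rpow_nonneg h0 _), ← Real.rpow_mul h0, inv_mul_cancel₀ hp.ne',
    Real.rpow_one]

theorem MeasureTheory.Lp.exists_norm_sub_rpow_le [InnerProductSpace ℝ E] [FiniteDimensional ℝ E]
    {p : ℝ} (hp : 1 < p) [Fact (1 ≤ ENNReal.ofReal p)] {ε : ℝ} (hε : 0 < ε) :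
    ∃ C : ℝ, 0 ≤ C ∧ ∀ u v : Lp E (ENNReal.ofReal p) μ,
      ‖u - v‖ ^ p ≤ ε * (‖u‖ ^ p + ‖v‖ ^ p) +
        C * ((‖u‖ ^ p + ‖v‖ ^ p) / 2 - ‖(1 / 2 : ℝ) • (u + v)‖ ^ p) := by
  have hp0 : 0 < p := by linarith
  obtain ⟨C, hC0, hC⟩ := _root_.exists_norm_sub_rpow_le (E := E) hp hε
  refine ⟨C, hC0, fun u v => ?_⟩
  simp only [Lp.norm_rpow_eq_integral hp0]
  have hi : ∀ w : Lp E (ENNReal.ofReal p) μ, Integrable (fun x => ‖w x‖ ^ p) μ :=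
    fun w => (Lp.memLp w).integrable_rpow_ofReal hp0
  have hu := hi u
  have hv := hi v
  have hm := hi ((1 / 2 : ℝ) • (u + v))
  have hr : ε * (∫ x, ‖u x‖ ^ p ∂μ + ∫ x, ‖v x‖ ^ p ∂μ) +
      C * ((∫ x, ‖u x‖ ^ p ∂μ + ∫ x, ‖v x‖ ^ p ∂μ) / 2 -
        ∫ x, ‖((1 / 2 : ℝ) • (u + v) : Lp E (ENNReal.ofReal p) μ) x‖ ^ p ∂μ) =
      ∫ x, (ε * (‖u x‖ ^ p + ‖v x‖ ^ p) + C * ((‖u x‖ ^ p + ‖v x‖ ^ p) / 2 -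
        ‖((1 / 2 : ℝ) • (u + v) : Lp E (ENNReal.ofReal p) μ) x‖ ^ p)) ∂μ := by
    have huv : Integrable (fun x => ‖u x‖ ^ p + ‖v x‖ ^ p) μ := hu.add hv
    have hd : Integrable (fun x => (‖u x‖ ^ p + ‖v x‖ ^ p) / 2 -
        ‖((1 / 2 : ℝ) • (u + v) : Lp E (ENNReal.ofReal p) μ) x‖ ^ p) μ := (huv.div_const 2).sub hm
    rw [integral_add (huv.const_mul ε) (hd.const_mul C),
      integral_const_mul, integral_const_mul, integral_sub (huv.div_const 2) hm,
      integral_div, integral_add hu hv]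
  rw [hr]
  refine integral_mono_ae (hi (u - v))
    (((hu.add hv).const_mul ε).add ((((hu.add hv).div_const 2).sub hm).const_mul C)) ?_
  filter_upwards [Lp.coeFn_sub u v, Lp.coeFn_smul (1 / 2 : ℝ) (u + v), Lp.coeFn_add u v]
    with x h1 h2 h3
  rw [h1, h2, Pi.smul_apply, h3, Pi.sub_apply, Pi.add_apply]
  exact hC (u x) (v x)

theorem MeasureTheory.MemLp.integrable_inner_of_holderConjugate [InnerProductSpace ℝ E] {p q : ℝ}
    (hpq : p.HolderConjugate q) {f g : α → E} (hf : MemLp f (ENNReal.ofReal p) μ)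
    (hg : MemLp g (ENNReal.ofReal q) μ) : Integrable (fun x => inner ℝ (f x) (g x)) μ := by
  have := hpq.ennrealOfReal
  have h := hf.norm.integrable_mul hg.norm
  refine h.mono (hf.1.inner hg.1) (Eventually.of_forall fun x => ?_)
  refine (norm_inner_le_norm _ _).trans ?_
  simp

/-- **Riesz representation** of the bounded functionals on `L^p`, `1 < p < ∞`, for
functions with values in a finite-dimensional inner product space. -/
theorem MeasureTheory.Lp.exists_forall_eq_integral_inner [InnerProductSpace ℝ E]
    [FiniteDimensional ℝ E] {p q : ℝ} (hpq : p.HolderConjugate q) [Fact (1 ≤ ENNReal.ofReal p)]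
    (ℓ : Lp E (ENNReal.ofReal p) μ →L[ℝ] ℝ) :
    ∃ ξ : α → E, MemLp ξ (ENNReal.ofReal q) μ ∧
      ∀ v : Lp E (ENNReal.ofReal p) μ, ℓ v = ∫ x, inner ℝ (v x) (ξ x) ∂μ := by
  have hp := hpq.lt
  have hp0 : 0 < p := hpq.pos
  have hq0 : 0 < q := hpq.symm.pos
  obtain ⟨u, hu⟩ := exists_forall_norm_rpow_sub_le hp
    (fun ε hε => Lp.exists_norm_sub_rpow_le (μ := μ) (E := E) hp hε) ℓ
  have hnorm : ∀ x : E, ‖‖x‖ ^ (p - 2) • x‖ = ‖x‖ ^ (p - 1) := by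
    intro x
    rw [norm_smul, Real.norm_of_nonneg (Real.rpow_nonneg (norm_nonneg _) _)]
    rcases eq_or_ne x 0 with rfl | hx
    · simp [Real.zero_rpow (sub_pos.2 hp).ne']
    · nth_rw 2 [← Real.rpow_one ‖x‖]
      rw [← Real.rpow_add (norm_pos_iff.2 hx)]
      ring_nf
  -- At the origin the exponent `p - 2` may be negative, but the norm `‖x‖ ^ (p - 1)` still tends to
  -- zero.
  have hcont : Continuous fun x : E => ‖x‖ ^ (p - 2) • x := by
    refine continuous_iff_continuousAt.2 fun x => ?_
    rcases eq_or_ne x 0 with rfl | hx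
    · rw [ContinuousAt, smul_zero, tendsto_zero_iff_norm_tendsto_zero]
      simp only [hnorm]
      have : Continuous fun x : E => ‖x‖ ^ (p - 1) :=
        continuous_norm.rpow_const fun _ => Or.inr (sub_pos.2 hp).le
      simpa [Real.zero_rpow (sub_pos.2 hp).ne'] using this.tendsto 0
    · exact (continuousAt_id.norm.rpow_const (Or.inl (norm_ne_zero_iff.2 hx))).smul continuousAt_id
  -- The representing field is read off from the Euler-Lagrange equation of the minimizer `u` of
  -- `‖u‖ ^ p / p - ℓ u`.
  set ξ : α → E := fun x => ‖u x‖ ^ (p - 2) • u x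
  have hum : AEStronglyMeasurable u μ := (Lp.memLp u).1
  have hξm : AEStronglyMeasurable ξ μ := hcont.comp_aestronglyMeasurable hum
  have hui := (Lp.memLp u).integrable_rpow_ofReal hp0
  refine ⟨ξ, ?_, fun v => ?_⟩
  · rw [memLp_ofReal_iff hq0 hξm]
    refine hui.congr (Eventually.of_forall fun x => ?_)
    simp only [ξ, hnorm]
    rw [← Real.rpow_mul (norm_nonneg _), hpq.sub_one_mul_conj]
  have hvm : AEStronglyMeasurable v μ := (Lp.memLp v).1
  have hvi := (Lp.memLp v).integrable_rpow_ofReal hp0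
  set F : ℝ → α → ℝ := fun t x => ‖u x + t • v x‖ ^ p
  set F' : ℝ → α → ℝ := fun t x =>
    p * inner ℝ (‖u x + t • v x‖ ^ (p - 2) • (u x + t • v x)) (v x)
  have hsm : ∀ t : ℝ, AEStronglyMeasurable (fun x => u x + t • v x) μ :=
    fun t => hum.add (hvm.const_smul t)
  have hFm : ∀ t, AEStronglyMeasurable (F t) μ := fun t =>
    (continuous_norm.rpow_const fun _ => Or.inr hp0.le).comp_aestronglyMeasurable (hsm t)
  have hsumi : MemLp (fun x => ‖u x‖ + ‖v x‖) (ENNReal.ofReal p) μ :=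
    (Lp.memLp u).norm.add (Lp.memLp v).norm
  have hsumi' := hsumi.integrable_rpow_ofReal hp0
  -- For `|t| ≤ 1` the derivative is dominated by `p (‖u‖ + ‖v‖) ^ p`, which is integrable.
  have hder := hasDerivAt_integral_of_dominated_loc_of_deriv_le (μ := μ) (F := F) (F' := F')
    (x₀ := (0 : ℝ)) (s := Metric.ball 0 1) (bound := fun x => p * ‖‖u x‖ + ‖v x‖‖ ^ p)
    (Metric.ball_mem_nhds _ one_pos) (Eventually.of_forall hFm)
    (by simpa [F] using hui)
    (((hcont.comp_aestronglyMeasurable (hsm 0)).inner hvm).const_mul p)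
    (Eventually.of_forall fun x t ht => ?_) (hsumi'.const_mul p)
    (Eventually.of_forall fun x t ht => ?_)
  · have hJ : HasDerivAt (fun t => (∫ x, F t x ∂μ) / p - (ℓ u + t * ℓ v))
        ((∫ x, F' 0 x ∂μ) / p - ℓ v) 0 := by
      have h2 : HasDerivAt (fun t : ℝ => ℓ u + t * ℓ v) (ℓ v) 0 := by
        simpa using ((hasDerivAt_id (0 : ℝ)).mul_const (ℓ v)).const_add (ℓ u)
      exact (hder.2.div_const p).sub h2
    have hmin : IsLocalMin (fun t => (∫ x, F t x ∂μ) / p - (ℓ u + t * ℓ v)) 0 := by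
      refine Eventually.of_forall fun t => ?_
      have h := hu (u + t • v)
      have h0 : ∀ t : ℝ, ‖u + t • v‖ ^ p = ∫ x, F t x ∂μ := by
        intro t
        rw [Lp.norm_rpow_eq_integral hp0]
        refine integral_congr_ae ?_
        filter_upwards [Lp.coeFn_add u (t • v), Lp.coeFn_smul t v] with x h1 h2
        rw [h1, Pi.add_apply, h2, Pi.smul_apply]
      have h1 := h0 0
      rw [zero_smul, add_zero] at h1
      rw [h0, h1, map_add, map_smul] at h
      simpa using h
    have hz := hmin.hasDerivAt_eq_zero hJ
    have h3 : ∫ x, F' 0 x ∂μ = p * ∫ x, inner ℝ (v x) (ξ x) ∂μ := by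
      rw [← integral_const_mul]
      refine integral_congr_ae (Eventually.of_forall fun x => ?_)
      simp only [F', ξ, zero_smul, add_zero]
      rw [real_inner_comm]
    rw [h3, mul_div_cancel_left₀ _ hp0.ne'] at hz
    linarith
  · have ht1 : |t| ≤ 1 := by
      rw [mem_ball_zero_iff, Real.norm_eq_abs] at ht
      exact ht.le
    have hle : ‖u x + t • v x‖ ≤ ‖u x‖ + ‖v x‖ := by
      refine (norm_add_le _ _).trans (add_le_add le_rfl ?_)
      rw [norm_smul, Real.norm_eq_abs]
      exact mul_le_of_le_one_left (norm_nonneg _) ht1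
    have hs0 : 0 ≤ ‖u x‖ + ‖v x‖ := by positivity
    rw [norm_mul, Real.norm_of_nonneg hp0.le, Real.norm_of_nonneg hs0]
    refine mul_le_mul_of_nonneg_left ?_ hp0.le
    refine (norm_inner_le_norm _ _).trans ?_
    rw [hnorm]
    calc ‖u x + t • v x‖ ^ (p - 1) * ‖v x‖ ≤
          (‖u x‖ + ‖v x‖) ^ (p - 1) * (‖u x‖ + ‖v x‖) := by
          refine mul_le_mul (Real.rpow_le_rpow (norm_nonneg _) hle (sub_pos.2 hp).le) ?_
            (norm_nonneg _) (Real.rpow_nonneg hs0 _)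
          linarith [norm_nonneg (u x)]
      _ = (‖u x‖ + ‖v x‖) ^ p := by
          rcases hs0.eq_or_lt with h | h
          · rw [← h, Real.zero_rpow hp0.ne', mul_zero]
          · rw [← Real.rpow_add_one h.ne']; ring_nf
  · have h1 : HasDerivAt (fun t : ℝ => u x + t • v x) (v x) t := by
      simpa using ((hasDerivAt_id t).smul_const (v x)).const_add (u x)
    have h2 := (hasFDerivAt_norm_rpow (u x + t • v x) hp).comp_hasDerivAt t h1
    refine h2.congr_deriv ?_
    simp only [F', smul_apply, innerSL_apply_apply, smul_eq_mul,
      real_inner_smul_left]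
    ring

end Riesz

/-! ### Hahn-Banach extension under a convex majorant. -/

section ConvexSeparation

/-- A linear functional that is dominated on a subspace by a finite continuous convex function
agrees on the subspace with a continuous functional dominated everywhere. -/
theorem exists_clm_eqOn_submodule_forall_sub_le {X : Type*} [NormedAddCommGroup X]
    [NormedSpace ℝ X] {I : X → ℝ} (hI : ConvexOn ℝ univ I) (hIc : Continuous I)
    (W : Submodule ℝ X) (η : X →ₗ[ℝ] ℝ) {S : ℝ} (hS : ∀ w ∈ W, η w - I w ≤ S) :
    ∃ ℓ : X →L[ℝ] ℝ, (∀ w ∈ W, ℓ w = η w) ∧ ∀ u, ℓ u - I u ≤ S := by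
  -- The strict epigraph of `I + S` is open and convex and misses the graph of `η` over `W`; a
  -- separating functional, normalized by its vertical coefficient, is the extension.
  set A : Set (X × ℝ) := {z | I z.1 + S < z.2}
  set B : Set (X × ℝ) := {z | z.1 ∈ W ∧ z.2 = η z.1}
  have hA : Convex ℝ A := by
    rintro ⟨u, s⟩ hu ⟨v, t⟩ hv a b ha hb hab
    have h := hI.2 (mem_univ u) (mem_univ v) ha hb hab
    simp only [A, mem_ofPred_eq, Prod.smul_mk, Prod.mk_add_mk, smul_eq_mul] at hu hv h ⊢
    have h3 : S = a * S + b * S := by rw [← add_mul, hab, one_mul]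
    rcases ha.eq_or_lt with rfl | ha
    · obtain rfl : b = 1 := by linarith
      simp only [zero_mul, one_mul] at h h3 ⊢
      linarith
    · have h1 : a * (I u + S) < a * s := mul_lt_mul_of_pos_left hu ha
      have h2 : b * (I v + S) ≤ b * t := mul_le_mul_of_nonneg_left hv.le hb
      linarith
  have hAo : IsOpen A :=
    isOpen_lt ((hIc.comp continuous_fst).add continuous_const) continuous_snd
  have hB : Convex ℝ B := by
    rintro ⟨u, s⟩ ⟨hu, hs⟩ ⟨v, t⟩ ⟨hv, ht⟩ a b ha hb hab
    refine ⟨W.add_mem (W.smul_mem a hu) (W.smul_mem b hv), ?_⟩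
    simp only at hs ht
    simp [hs, ht]
  have hdisj : Disjoint A B := by
    rw [Set.disjoint_left]
    rintro ⟨u, s⟩ hu ⟨hw, hs⟩
    have := hS u hw
    simp only [A, mem_ofPred_eq] at hu hs
    linarith
  obtain ⟨Φ, s, hAs, hBs⟩ := geometric_hahn_banach_open hA hAo hB hdisj
  have hs0 : s ≤ 0 := by
    have := hBs 0 ⟨W.zero_mem, by simp⟩
    simpa using this
  have hΦ : ∀ u t, Φ (u, t) = Φ (u, 0) + t * Φ (0, 1) := by
    intro u t
    rw [← smul_eq_mul t, ← map_smul, ← map_add]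
    simp
  set c := Φ (0, 1)
  -- The graph is a linear subspace on which `Φ` is bounded below, so `Φ` vanishes on it.
  have hBz : ∀ w ∈ W, Φ (w, η w) = 0 := by
    intro w hw
    by_contra hne
    have h := hBs (((s - 1) / Φ (w, η w)) • (w, η w))
      ⟨W.smul_mem _ hw, by simp⟩
    rw [map_smul, smul_eq_mul, div_mul_cancel₀ _ hne] at h
    linarith
  have hA0 : ∀ t, I 0 + S < t → t * c < s := by
    intro t ht
    have := hAs (0, t) ht
    rw [hΦ] at this
    have h0 : Φ (0, 0) = 0 := by rw [← Prod.zero_eq_mk, map_zero]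
    rwa [h0, zero_add] at this
  -- `A` contains `(0, t)` for all large `t`, whereas `t * c < s ≤ 0` there; hence the separating
  -- hyperplane is not vertical.
  have hc : c < 0 := by
    have h1 := hA0 (|I 0 + S| + 1) (by linarith [le_abs_self (I 0 + S)])
    by_contra! hc
    have : 0 ≤ (|I 0 + S| + 1) * c := by positivity
    linarith
  refine ⟨(-c)⁻¹ • Φ.comp (ContinuousLinearMap.inl ℝ X ℝ), fun w hw => ?_, fun u => ?_⟩
  · have h := hBz w hw
    rw [hΦ] at h
    have h1 : Φ (w, 0) = -c * η w := by linarith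
    simp only [smul_apply, ContinuousLinearMap.comp_apply, ContinuousLinearMap.inl_apply,
      smul_eq_mul, h1]
    rw [inv_mul_cancel_left₀ (neg_pos.2 hc).ne']
  · simp only [smul_apply, ContinuousLinearMap.comp_apply, ContinuousLinearMap.inl_apply,
      smul_eq_mul]
    refine le_of_forall_pos_le_add fun ε hε => ?_
    have h := hAs (u, I u + S + ε) (by simp only [A, mem_ofPred_eq]; linarith)
    rw [hΦ] at h
    have h1 : Φ (u, 0) < -c * (I u + S + ε) := by linarith
    have h2 : (-c)⁻¹ * Φ (u, 0) < I u + S + ε := by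
      rwa [inv_mul_lt_iff₀ (neg_pos.2 hc)]
    linarith

end ConvexSeparation

/-! ### Young inequalities for powers of the norm. -/

section Young

variable {E : Type*} [NormedAddCommGroup E] [InnerProductSpace ℝ E] {p q : ℝ}

theorem exists_inner_le_add_rpow (hpq : p.HolderConjugate q) {c : ℝ} (hc : 0 < c) :
    ∃ C : ℝ, 0 < C ∧ ∀ a b : E, inner ℝ a b ≤ c * ‖a‖ ^ p + C * ‖b‖ ^ q := by
  set κ : ℝ := c ^ (1 / p)
  have hκ : 0 < κ := Real.rpow_pos_of_pos hc _
  have hκp : κ ^ p = c := by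
    rw [← Real.rpow_mul hc.le, one_div_mul_cancel hpq.pos.ne', Real.rpow_one]
  refine ⟨(κ⁻¹) ^ q, Real.rpow_pos_of_pos (inv_pos.2 hκ) _, fun a b => ?_⟩
  have h := Real.young_inequality_of_nonneg (a := κ * ‖a‖) (b := κ⁻¹ * ‖b‖) (by positivity)
    (by positivity) hpq
  rw [Real.mul_rpow hκ.le (norm_nonneg _), Real.mul_rpow (inv_pos.2 hκ).le (norm_nonneg _),
    hκp] at h
  have h1 : κ * ‖a‖ * (κ⁻¹ * ‖b‖) = ‖a‖ * ‖b‖ := by field_simp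
  have h2 : c * ‖a‖ ^ p / p ≤ c * ‖a‖ ^ p := div_le_self (by positivity) hpq.lt.le
  have h3 : κ⁻¹ ^ q * ‖b‖ ^ q / q ≤ κ⁻¹ ^ q * ‖b‖ ^ q := div_le_self (by positivity) hpq.symm.lt.le
  have h4 := real_inner_le_norm a b
  linarith

/-- This makes the conjugate of an integrand with `p`-growth coercive of order `q`. The vector `a`
is taken parallel to `b` with length `l ‖b‖ ^ (q - 1)`. -/
theorem exists_le_inner_sub_rpow (hpq : p.HolderConjugate q) {c : ℝ} (hc : 0 < c) :
    ∃ C : ℝ, 0 < C ∧ ∀ b : E, ∃ a : E, C * ‖b‖ ^ q ≤ inner ℝ a b - c * ‖a‖ ^ p := by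
  have hp1 : 0 < p - 1 := sub_pos.2 hpq.lt
  -- Chosen so that `c * l ^ p = l / 2`: the power term eats exactly half of the linear gain.
  set l : ℝ := (1 / (2 * c)) ^ (1 / (p - 1))
  have hl : 0 < l := Real.rpow_pos_of_pos (by positivity) _
  have hlp : c * l ^ p = l / 2 := by
    have h1 : l ^ (p - 1) = 1 / (2 * c) := by
      rw [← Real.rpow_mul (by positivity), one_div_mul_cancel hp1.ne', Real.rpow_one]
    have h2 : l ^ p = l ^ (p - 1) * l := by
      rw [← Real.rpow_add_one hl.ne']; ring_nf
    rw [h2, h1]; field_simp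
  refine ⟨l / 2, by positivity, fun b => ?_⟩
  rcases eq_or_ne b 0 with rfl | hb
  · refine ⟨0, ?_⟩
    simp [Real.zero_rpow hpq.symm.pos.ne', Real.zero_rpow hpq.pos.ne']
  have hb0 : 0 < ‖b‖ := norm_pos_iff.2 hb
  set s : ℝ := l * ‖b‖ ^ (q - 1)
  have hs : 0 < s := by positivity
  refine ⟨(s / ‖b‖) • b, ?_⟩
  have hn : ‖(s / ‖b‖) • b‖ = s := by
    rw [norm_smul, Real.norm_of_nonneg (by positivity), div_mul_cancel₀ _ hb0.ne']
  have hin : inner ℝ ((s / ‖b‖) • b) b = s * ‖b‖ := by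
    rw [real_inner_smul_left, real_inner_self_eq_norm_sq]; field_simp
  have hsp : c * s ^ p = l / 2 * ‖b‖ ^ q := by
    rw [Real.mul_rpow hl.le (by positivity), ← Real.rpow_mul hb0.le, ← mul_assoc, hlp,
      hpq.symm.sub_one_mul_conj]
  have hsb : s * ‖b‖ = l * ‖b‖ ^ q := by
    rw [mul_assoc, ← Real.rpow_add_one hb0.ne']; ring_nf
  rw [hn, hin, hsp, hsb]
  linarith

end Young

/-! ### Fenchel conjugation in finite dimension. -/

namespace PeriodicCell

variable {N : ℕ}

theorem conj_le {F : Vec N → Vec N → ℝ} {a' b' : Vec N} {t : ℝ}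
    (h : ∀ a b, inner ℝ a a' + inner ℝ b b' - F a b ≤ t) : conj F a' b' ≤ t := by
  refine csSup_le (range_nonempty _) ?_
  rintro _ ⟨z, rfl⟩
  exact h z.1 z.2

theorem le_conj {F : Vec N → Vec N → ℝ} {a' b' : Vec N} (hF : BddAbove (conjValues F a' b'))
    (a b : Vec N) : inner ℝ a a' + inner ℝ b b' - F a b ≤ conj F a' b' :=
  le_csSup hF ⟨(a, b), rfl⟩

theorem bddAbove_conjValues {F : Vec N → Vec N → ℝ} {a' b' : Vec N} {t : ℝ}
    (h : ∀ a b, inner ℝ a a' + inner ℝ b b' - F a b ≤ t) : BddAbove (conjValues F a' b') := by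
  refine ⟨t, ?_⟩
  rintro _ ⟨z, rfl⟩
  exact h z.1 z.2

theorem convexOn_conj {F : Vec N → Vec N → ℝ} (hF : ∀ a' b', BddAbove (conjValues F a' b')) :
    ConvexOn ℝ univ fun z : Vec N × Vec N => conj F z.1 z.2 := by
  refine ⟨convex_univ, fun u _ v _ s t hs ht hst => conj_le fun a b => ?_⟩
  have h1 := mul_le_mul_of_nonneg_left (le_conj (hF u.1 u.2) a b) hs
  have h2 := mul_le_mul_of_nonneg_left (le_conj (hF v.1 v.2) a b) ht
  have h3 : F a b = s * F a b + t * F a b := by rw [← add_mul, hst, one_mul]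
  simp only [Prod.fst_add, Prod.snd_add, Prod.smul_fst, Prod.smul_snd, inner_add_right,
    real_inner_smul_right, smul_eq_mul]
  linarith

/-- **Fenchel-Moreau** for finite convex functions. -/
theorem conj_conj {F : Vec N → Vec N → ℝ}
    (hc : ConvexOn ℝ univ fun z : Vec N × Vec N => F z.1 z.2)
    (hF : ∀ a' b', BddAbove (conjValues F a' b')) (a b : Vec N) : conj (conj F) a b = F a b := by
  have hle : ∀ a' b', inner ℝ a' a + inner ℝ b' b - conj F a' b' ≤ F a b := by
    intro a' b'
    have := le_conj (hF a' b') a b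
    rw [real_inner_comm, real_inner_comm b]
    linarith
  refine le_antisymm (conj_le hle) (le_of_forall_lt fun s hs => ?_)
  obtain ⟨t, hst, ht⟩ := exists_between hs
  have hcont : Continuous fun z : Vec N × Vec N => F z.1 z.2 := hc.locallyLipschitz.continuous
  -- An affine minorant exceeding `t` at `(a, b)`. Its slope `(a', b')` satisfies `conj F a' b' ≤
  -- -c`, so it witnesses that the biconjugate is above `t`.
  obtain ⟨l, c, hl, hlc⟩ := ConvexOn.exists_affine_le_of_lt (𝕜 := ℝ) (mem_univ (a, b)) ht
    isClosed_univ (hcont.lowerSemicontinuous.lowerSemicontinuousOn _) hc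
  set a' := (InnerProductSpace.toDual ℝ (Vec N)).symm
    (l.comp (ContinuousLinearMap.inl ℝ (Vec N) (Vec N)))
  set b' := (InnerProductSpace.toDual ℝ (Vec N)).symm
    (l.comp (ContinuousLinearMap.inr ℝ (Vec N) (Vec N)))
  have hl' : ∀ x y, l (x, y) = inner ℝ x a' + inner ℝ y b' := by
    intro x y
    rw [real_inner_comm, real_inner_comm b']
    simp only [a', b', InnerProductSpace.toDual_symm_apply, ContinuousLinearMap.comp_apply,
      ContinuousLinearMap.inl_apply, ContinuousLinearMap.inr_apply, ← map_add]
    simp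
  have hle' : ∀ x y, inner ℝ x a' + inner ℝ y b' + c ≤ F x y := by
    intro x y
    have := hl ⟨(x, y), mem_univ _⟩
    simp only [Pi.add_apply, Set.domRestrict_apply, Function.comp_apply, RCLike.re_to_real,
      Function.const_apply, hl'] at this
    exact this
  have hconj : conj F a' b' ≤ -c := conj_le fun x y => by linarith [hle' x y]
  have h := le_conj (bddAbove_conjValues (F := conj F) hle) a' b'
  simp only [RCLike.re_to_real, hl'] at hlc
  rw [real_inner_comm, real_inner_comm b] at h
  linarith

end PeriodicCell

/-! ### Measurability of superpositions. -/

section Caratheodory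

open Filter Topology

/-- Superposition with a Carathéodory function preserves a.e. strong measurability. -/
theorem aestronglyMeasurable_comp_of_ae_continuous {α F : Type*} [MeasurableSpace α]
    {μ : Measure α} [TopologicalSpace F] {f : α → F → ℝ}
    (hm : ∀ c, AEStronglyMeasurable (fun x => f x c) μ) (hc : ∀ᵐ x ∂μ, Continuous (f x))
    {u : α → F} (hu : AEStronglyMeasurable u μ) :
    AEStronglyMeasurable (fun x => f x (u x)) μ := by
  set s := hu.stronglyMeasurable_mk.approx
  have hs : ∀ n, AEStronglyMeasurable (fun x => f x (s n x)) μ := by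
    intro n
    -- A simple function has finitely many values, so the superposition is a finite sum of sections
    -- `f · y` cut off to level sets.
    have h : (fun x => f x (s n x)) =
        fun x => ∑ y ∈ (s n).range, ((s n) ⁻¹' {y}).indicator (fun x => f x y) x := by
      funext x
      rw [Finset.sum_eq_single (s n x)]
      · simp
      · intro y _ hy
        exact indicator_of_notMem (fun h => hy h.symm) _
      · exact fun h => absurd (SimpleFunc.mem_range_self _ _) h
    rw [h]
    exact Finset.aestronglyMeasurable_fun_sum _ fun y _ =>
      (hm y).indicator ((s n).measurableSet_fiber y)
  refine aestronglyMeasurable_of_tendsto_ae atTop hs ?_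
  filter_upwards [hc, hu.ae_eq_mk] with x hx hux
  rw [hux]
  exact (hx.tendsto _).comp (hu.stronglyMeasurable_mk.tendsto_approx x)

end Caratheodory

/-! ### Convex integral functionals on `L^p × L^q` and their conjugates. -/

namespace PeriodicCell

open Filter Topology

variable {N : ℕ} {α : Type*} [MeasurableSpace α] {μ : Measure α} {p q p' q' : ℝ}
  {f : α → Vec N → Vec N → ℝ}

/-- A convex Carathéodory integrand on `ℝ^N × ℝ^N` with growth of order `p` in the first and of
order `q` in the second variable. -/
structure IsGrowthIntegrand (μ : Measure α) (p q : ℝ) (f : α → Vec N → Vec N → ℝ) : Prop where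
  aestronglyMeasurable : ∀ a b, AEStronglyMeasurable (fun x => f x a b) μ
  convex : ∀ᵐ x ∂μ, ConvexOn ℝ univ fun z : Vec N × Vec N => f x z.1 z.2
  growth : ∃ (c₀ c₁ : ℝ) (n₀ n₁ : α → ℝ), 0 < c₀ ∧ 0 < c₁ ∧ Integrable n₀ μ ∧ Integrable n₁ μ ∧
    ∀ᵐ x ∂μ, ∀ a b, c₀ * (‖a‖ ^ p + ‖b‖ ^ q) - n₀ x ≤ f x a b ∧
      f x a b ≤ c₁ * (‖a‖ ^ p + ‖b‖ ^ q) + n₁ x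

namespace IsGrowthIntegrand

theorem ae_continuous (hf : IsGrowthIntegrand μ p q f) :
    ∀ᵐ x ∂μ, Continuous fun z : Vec N × Vec N => f x z.1 z.2 :=
  hf.convex.mono fun _ h => h.locallyLipschitz.continuous

theorem aestronglyMeasurable_comp (hf : IsGrowthIntegrand μ p q f) {u w : α → Vec N}
    (hu : AEStronglyMeasurable u μ) (hw : AEStronglyMeasurable w μ) :
    AEStronglyMeasurable (fun x => f x (u x) (w x)) μ :=
  aestronglyMeasurable_comp_of_ae_continuous (f := fun x (z : Vec N × Vec N) => f x z.1 z.2)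
    (fun z => hf.aestronglyMeasurable z.1 z.2) hf.ae_continuous (hu.prodMk hw)

theorem integrable_comp (hf : IsGrowthIntegrand μ p q f) (hp : 0 < p) (hq : 0 < q)
    {u w : α → Vec N} (hu : MemLp u (ENNReal.ofReal p) μ) (hw : MemLp w (ENNReal.ofReal q) μ) :
    Integrable (fun x => f x (u x) (w x)) μ := by
  obtain ⟨c₀, c₁, n₀, n₁, h0, h1, hn0, hn1, hb⟩ := hf.growth
  have hi : Integrable (fun x => ‖u x‖ ^ p + ‖w x‖ ^ q) μ :=
    (hu.integrable_rpow_ofReal hp).add (hw.integrable_rpow_ofReal hq)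
  exact integrable_of_le_of_le (hf.aestronglyMeasurable_comp hu.1 hw.1)
    (hb.mono fun x hx => (hx (u x) (w x)).1) (hb.mono fun x hx => (hx (u x) (w x)).2)
    ((hi.const_mul c₀).sub hn0) ((hi.const_mul c₁).add hn1)

/-- Young's inequality with constant `c₀` absorbs the pairing into the coercivity of `f`. The bound
is stated for the values under the supremum because `conj` is a real `sSup`, meaningful only once
these are bounded above. -/
theorem exists_ae_conj_bound (hf : IsGrowthIntegrand μ p q f) (hp : p.HolderConjugate p')
    (hq : q.HolderConjugate q') :
    ∃ (c₁ : ℝ) (n₁ : α → ℝ), 0 < c₁ ∧ Integrable n₁ μ ∧ ∀ᵐ x ∂μ, ∀ a' b' a b : Vec N,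
      inner ℝ a a' + inner ℝ b b' - f x a b ≤ c₁ * (‖a'‖ ^ p' + ‖b'‖ ^ q') + n₁ x := by
  obtain ⟨c₀, c₁, n₀, n₁, h0, h1, hn0, hn1, hb⟩ := hf.growth
  obtain ⟨A, hA, hA'⟩ := exists_inner_le_add_rpow (E := Vec N) hp h0
  obtain ⟨B, _, hB'⟩ := exists_inner_le_add_rpow (E := Vec N) hq h0
  refine ⟨max A B, n₀, lt_max_of_lt_left hA, hn0, hb.mono fun x hx a' b' a b => ?_⟩
  have e1 := hA' a a'
  have e2 := hB' b b'
  have e3 := (hx a b).1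
  have e4 : A * ‖a'‖ ^ p' ≤ max A B * ‖a'‖ ^ p' :=
    mul_le_mul_of_nonneg_right (le_max_left _ _) (by positivity)
  have e5 : B * ‖b'‖ ^ q' ≤ max A B * ‖b'‖ ^ q' :=
    mul_le_mul_of_nonneg_right (le_max_right _ _) (by positivity)
  linarith

theorem ae_bddAbove_conjValues (hf : IsGrowthIntegrand μ p q f) (hp : p.HolderConjugate p')
    (hq : q.HolderConjugate q') :
    ∀ᵐ x ∂μ, ∀ a' b', BddAbove (conjValues (f x) a' b') := by
  obtain ⟨c₁, n₁, -, -, h⟩ := hf.exists_ae_conj_bound hp hq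
  exact h.mono fun x hx a' b' => bddAbove_conjValues (hx a' b')

/-- Continuity reduces the supremum to a countable dense set; both the measurability of the
conjugate and the measurable selection rest on this. -/
theorem exists_lt_denseSeq_of_lt_conj {F : Vec N → Vec N → ℝ}
    (hF : Continuous fun z : Vec N × Vec N => F z.1 z.2) {a' b' : Vec N}
    (hb : BddAbove (conjValues F a' b')) {t : ℝ} (ht : t < conj F a' b') :
    ∃ k, t < inner ℝ (TopologicalSpace.denseSeq (Vec N × Vec N) k).1 a' +
      inner ℝ (TopologicalSpace.denseSeq (Vec N × Vec N) k).2 b' -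
      F (TopologicalSpace.denseSeq (Vec N × Vec N) k).1
        (TopologicalSpace.denseSeq (Vec N × Vec N) k).2 := by
  obtain ⟨_, ⟨z, rfl⟩, hz⟩ := exists_lt_of_lt_csSup (range_nonempty _) ht
  have hcont : Continuous fun z : Vec N × Vec N => inner ℝ z.1 a' + inner ℝ z.2 b' - F z.1 z.2 :=
    (by fun_prop : Continuous fun z : Vec N × Vec N => inner ℝ z.1 a' + inner ℝ z.2 b').sub hF
  exact (TopologicalSpace.denseRange_denseSeq _).exists_mem_open
    (isOpen_lt continuous_const hcont) ⟨z, hz⟩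

/-- Conjugation reverses order, so the upper growth bound of `f` becomes coercivity of the conjugate
and the lower bound becomes its upper growth. -/
protected theorem conj (hf : IsGrowthIntegrand μ p q f) (hp : p.HolderConjugate p')
    (hq : q.HolderConjugate q') : IsGrowthIntegrand μ p' q' fun x => conj (f x) where
  aestronglyMeasurable a' b' := by
    set c := TopologicalSpace.denseSeq (Vec N × Vec N)
    have h : AEMeasurable (fun x => ⨆ k, (inner ℝ (c k).1 a' + inner ℝ (c k).2 b' -
        f x (c k).1 (c k).2)) μ := by
      refine AEMeasurable.iSup fun k => ?_
      exact aemeasurable_const.sub (hf.aestronglyMeasurable _ _).aemeasurable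
    refine h.aestronglyMeasurable.congr ?_
    filter_upwards [hf.ae_bddAbove_conjValues hp hq, hf.ae_continuous] with x hx hxc
    have hbd : BddAbove (range fun k => inner ℝ (c k).1 a' + inner ℝ (c k).2 b' -
        f x (c k).1 (c k).2) := by
      refine (hx a' b').mono ?_
      rintro _ ⟨k, rfl⟩
      exact ⟨c k, rfl⟩
    refine le_antisymm (ciSup_le fun k => le_conj (hx a' b') _ _) (le_of_forall_lt fun t ht => ?_)
    obtain ⟨k, hk⟩ := exists_lt_denseSeq_of_lt_conj hxc (hx a' b') ht
    exact hk.trans_le (le_ciSup hbd k)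
  convex := (hf.ae_bddAbove_conjValues hp hq).mono fun x hx => convexOn_conj hx
  growth := by
    obtain ⟨C, m, hC, hm, hup⟩ := hf.exists_ae_conj_bound hp hq
    obtain ⟨c₀, c₁, n₀, n₁, h0, h1, hn0, hn1, hb⟩ := hf.growth
    obtain ⟨A, hA, hA'⟩ := exists_le_inner_sub_rpow (E := Vec N) hp h1
    obtain ⟨B, hB, hB'⟩ := exists_le_inner_sub_rpow (E := Vec N) hq h1
    refine ⟨min A B, C, n₁, m, lt_min hA hB, hC, hn1, hm, ?_⟩
    filter_upwards [hup, hb, hf.ae_bddAbove_conjValues hp hq] with x hx1 hx2 hx3 a' b'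
    refine ⟨?_, conj_le (hx1 a' b')⟩
    obtain ⟨a, ha⟩ := hA' a'
    obtain ⟨b, hb⟩ := hB' b'
    have e1 := le_conj (hx3 a' b') a b
    have e2 := (hx2 a b).2
    have e4 : min A B * ‖a'‖ ^ p' ≤ A * ‖a'‖ ^ p' :=
      mul_le_mul_of_nonneg_right (min_le_left _ _) (by positivity)
    have e5 : min A B * ‖b'‖ ^ q' ≤ B * ‖b'‖ ^ q' :=
      mul_le_mul_of_nonneg_right (min_le_right _ _) (by positivity)
    linarith

theorem ae_conj_conj (hf : IsGrowthIntegrand μ p q f) (hp : p.HolderConjugate p')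
    (hq : q.HolderConjugate q') : ∀ᵐ x ∂μ, ∀ a b, conj (conj (f x)) a b = f x a b := by
  filter_upwards [hf.convex, hf.ae_bddAbove_conjValues hp hq] with x h1 h2 a b
  exact conj_conj h1 h2 a b

/-- Almost optimal measurable selections in the definition of the conjugate integrand. -/
theorem exists_memLp_sub_le (hf : IsGrowthIntegrand μ p q f) (hp : p.HolderConjugate p')
    (hq : q.HolderConjugate q') [IsFiniteMeasure μ] {ξ η : α → Vec N}
    (hξ : MemLp ξ (ENNReal.ofReal p') μ) (hη : MemLp η (ENNReal.ofReal q') μ) {ε : ℝ}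
    (hε : 0 < ε) :
    ∃ u w : α → Vec N, MemLp u (ENNReal.ofReal p) μ ∧ MemLp w (ENNReal.ofReal q) μ ∧
      ∀ᵐ x ∂μ, conj (f x) (ξ x) (η x) - ε ≤
        inner ℝ (u x) (ξ x) + inner ℝ (w x) (η x) - f x (u x) (w x) := by
  classical
  set c := TopologicalSpace.denseSeq (Vec N × Vec N)
  have hconj := hf.conj hp hq
  have hHm : AEMeasurable (fun x => conj (f x) (ξ x) (η x)) μ :=
    (hconj.aestronglyMeasurable_comp hξ.1 hη.1).aemeasurable
  have hFm : ∀ k, AEMeasurable (fun x => inner ℝ (c k).1 (ξ x) + inner ℝ (c k).2 (η x) -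
      f x (c k).1 (c k).2) μ := fun k =>
    (((aestronglyMeasurable_const.inner hξ.1).add (aestronglyMeasurable_const.inner hη.1)).sub
      (hf.aestronglyMeasurable _ _)).aemeasurable
  set H := hHm.mk
  set F := fun k => (hFm k).mk
  -- The second alternative lets `Nat.find` be defined at every point, including the null set where
  -- no index is good for the measurable representatives.
  set P : α → ℕ → Prop := fun x k => H x - ε ≤ F k x ∨ ∀ j, ¬ (H x - ε ≤ F j x)
  have hPm : ∀ k, MeasurableSet {x | H x - ε ≤ F k x} := fun k =>
    measurableSet_le (hHm.measurable_mk.sub_const ε) (hFm k).measurable_mk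
  have hP : ∀ x, ∃ k, P x k := by
    intro x
    by_cases h : ∃ k, H x - ε ≤ F k x
    · exact ⟨h.choose, Or.inl h.choose_spec⟩
    · exact ⟨0, Or.inr (not_exists.1 h)⟩
  have hκ : Measurable fun x => Nat.find (hP x) := by
    have hno : MeasurableSet {x | ∀ j, ¬ (H x - ε ≤ F j x)} := by
      rw [show {x | ∀ j, ¬ (H x - ε ≤ F j x)} = ⋂ j, {x | H x - ε ≤ F j x}ᶜ by ext x; simp]
      exact MeasurableSet.iInter fun j => (hPm j).compl
    exact measurable_find hP fun k => (hPm k).union hno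
  set κ := fun x => Nat.find (hP x)
  have hu : Measurable fun x => (c (κ x)).1 := (measurable_of_countable fun k => (c k).1).comp hκ
  have hw : Measurable fun x => (c (κ x)).2 := (measurable_of_countable fun k => (c k).2).comp hκ
  have hsel : ∀ᵐ x ∂μ, conj (f x) (ξ x) (η x) - ε ≤ inner ℝ (c (κ x)).1 (ξ x) +
      inner ℝ (c (κ x)).2 (η x) - f x (c (κ x)).1 (c (κ x)).2 := by
    filter_upwards [hHm.ae_eq_mk, ae_all_iff.2 fun k => (hFm k).ae_eq_mk,
      hf.ae_bddAbove_conjValues hp hq, hf.ae_continuous] with x h1 h2 h3 h4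
    obtain ⟨k, hk⟩ := exists_lt_denseSeq_of_lt_conj h4 (h3 (ξ x) (η x)) (sub_lt_self _ hε)
    rcases Nat.find_spec (hP x) with h | h
    · rw [h1, h2]; exact h
    · exfalso
      refine h k ?_
      simp only [H, F]
      rw [← h1, ← h2]
      exact hk.le
  obtain ⟨c₀, c₁, n₀, n₁, h0, h1, hn0, hn1, hb⟩ := hf.growth
  obtain ⟨d₀, d₁, m₀, m₁, hd0, hd1, hm0, hm1, hd⟩ := hconj.growth
  -- Half of the coercivity of `f` absorbs the pairing. The other half bounds the selection, since
  -- near-optimality and the lower bound on the conjugate control `f` from above along it.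
  obtain ⟨A, hA, hA'⟩ := exists_inner_le_add_rpow (E := Vec N) hp (half_pos h0)
  obtain ⟨B, hB, hB'⟩ := exists_inner_le_add_rpow (E := Vec N) hq (half_pos h0)
  have hξi := hξ.integrable_rpow_ofReal hp.symm.pos
  have hηi := hη.integrable_rpow_ofReal hq.symm.pos
  set b : α → ℝ := fun x => 2 / c₀ * (A * ‖ξ x‖ ^ p' + B * ‖η x‖ ^ q' + n₀ x + m₀ x + ε)
  have hbi : Integrable b μ :=
    (((((hξi.const_mul A).add (hηi.const_mul B)).add hn0).add hm0).add
      (integrable_const ε)).const_mul _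
  have hbound : ∀ᵐ x ∂μ, ‖(c (κ x)).1‖ ^ p + ‖(c (κ x)).2‖ ^ q ≤ b x := by
    filter_upwards [hsel, hb, hd] with x h2 h3 h4
    have e1 := (h3 (c (κ x)).1 (c (κ x)).2).1
    have e2 := (h4 (ξ x) (η x)).1
    have e3 := hA' (c (κ x)).1 (ξ x)
    have e4 := hB' (c (κ x)).2 (η x)
    have e5 : 0 ≤ d₀ * (‖ξ x‖ ^ p' + ‖η x‖ ^ q') := by positivity
    have e6 : c₀ / 2 * (‖(c (κ x)).1‖ ^ p + ‖(c (κ x)).2‖ ^ q) ≤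
        A * ‖ξ x‖ ^ p' + B * ‖η x‖ ^ q' + n₀ x + m₀ x + ε := by linarith
    simp only [b]
    rw [← inv_div c₀ 2, le_inv_mul_iff₀ (half_pos h0)]
    exact e6
  refine ⟨fun x => (c (κ x)).1, fun x => (c (κ x)).2, ?_, ?_, hsel⟩
  · rw [memLp_ofReal_iff hp.pos hu.aestronglyMeasurable]
    refine hbi.mono' (hu.norm.pow_const p).aestronglyMeasurable (hbound.mono fun x hx => ?_)
    rw [Real.norm_of_nonneg (by positivity)]
    exact (le_add_of_nonneg_right (by positivity)).trans hx
  · rw [memLp_ofReal_iff hq.pos hw.aestronglyMeasurable]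
    refine hbi.mono' (hw.norm.pow_const q).aestronglyMeasurable (hbound.mono fun x hx => ?_)
    rw [Real.norm_of_nonneg (by positivity)]
    exact (le_add_of_nonneg_left (by positivity)).trans hx

/-- The conjugate of an integral functional is bounded below by the integral of the conjugate
integrand. -/
theorem integral_conj_le (hf : IsGrowthIntegrand μ p q f) (hp : p.HolderConjugate p')
    (hq : q.HolderConjugate q') [IsFiniteMeasure μ] {ξ η : α → Vec N}
    (hξ : MemLp ξ (ENNReal.ofReal p') μ) (hη : MemLp η (ENNReal.ofReal q') μ) {S : ℝ}
    (hS : ∀ u w : α → Vec N, MemLp u (ENNReal.ofReal p) μ → MemLp w (ENNReal.ofReal q) μ →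
      ∫ x, inner ℝ (u x) (ξ x) ∂μ + ∫ x, inner ℝ (w x) (η x) ∂μ - ∫ x, f x (u x) (w x) ∂μ ≤ S) :
    ∫ x, conj (f x) (ξ x) (η x) ∂μ ≤ S := by
  have hH : Integrable (fun x => conj (f x) (ξ x) (η x)) μ :=
    (hf.conj hp hq).integrable_comp hp.symm.pos hq.symm.pos hξ hη
  have key : ∀ ε : ℝ, 0 < ε → ∫ x, conj (f x) (ξ x) (η x) ∂μ ≤ S + ε * μ.real univ := by
    intro ε hε
    obtain ⟨u, w, hu, hw, hle⟩ := hf.exists_memLp_sub_le hp hq hξ hη hε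
    have h1 := hu.integrable_inner_of_holderConjugate hp hξ
    have h2 := hw.integrable_inner_of_holderConjugate hq hη
    have h3 := hf.integrable_comp hp.pos hq.pos hu hw
    have h4 := integral_mono_ae (hH.sub (integrable_const ε)) ((h1.add h2).sub h3) hle
    simp only [Pi.sub_apply, Pi.add_apply] at h4
    rw [integral_sub hH (integrable_const ε), integral_const, smul_eq_mul] at h4
    have h5 : ∫ x, (inner ℝ (u x) (ξ x) + inner ℝ (w x) (η x) - f x (u x) (w x)) ∂μ =
        ∫ x, inner ℝ (u x) (ξ x) ∂μ + ∫ x, inner ℝ (w x) (η x) ∂μ - ∫ x, f x (u x) (w x) ∂μ := by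
      rw [← integral_add h1 h2]
      exact integral_sub (h1.add h2) h3
    rw [h5] at h4
    have h6 := hS u w hu hw
    linarith
  have hT : Tendsto (fun ε : ℝ => S + ε * μ.real univ) (𝓝[>] 0) (𝓝 S) := by
    have : Continuous fun ε : ℝ => S + ε * μ.real univ := by fun_prop
    have h := (this.tendsto 0).mono_left (nhdsWithin_le_nhds (s := Ioi (0 : ℝ)))
    simpa using h
  exact ge_of_tendsto hT (eventually_mem_nhdsWithin.mono fun ε hε => key ε hε)

/-- A convex function that is bounded above near one point is continuous; the upper growth bound
supplies a continuous majorant in terms of the norms. -/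
theorem continuous_integral (hf : IsGrowthIntegrand μ p q f) (hp : 0 < p) (hq : 0 < q)
    [Fact (1 ≤ ENNReal.ofReal p)] [Fact (1 ≤ ENNReal.ofReal q)] :
    ConvexOn ℝ univ (fun z : Lp (Vec N) (ENNReal.ofReal p) μ × Lp (Vec N) (ENNReal.ofReal q) μ =>
        ∫ x, f x (z.1 x) (z.2 x) ∂μ) ∧
      Continuous (fun z : Lp (Vec N) (ENNReal.ofReal p) μ × Lp (Vec N) (ENNReal.ofReal q) μ =>
        ∫ x, f x (z.1 x) (z.2 x) ∂μ) := by
  set I := fun z : Lp (Vec N) (ENNReal.ofReal p) μ × Lp (Vec N) (ENNReal.ofReal q) μ =>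
        ∫ x, f x (z.1 x) (z.2 x) ∂μ
  have hi : ∀ z : Lp (Vec N) (ENNReal.ofReal p) μ × Lp (Vec N) (ENNReal.ofReal q) μ,
      Integrable (fun x => f x (z.1 x) (z.2 x)) μ := fun z =>
    hf.integrable_comp hp hq (Lp.memLp _) (Lp.memLp _)
  have hconv : ConvexOn ℝ univ I := by
    refine ⟨convex_univ, fun u _ v _ s t hs ht hst => ?_⟩
    simp only [I, smul_eq_mul]
    rw [← integral_const_mul, ← integral_const_mul,
      ← integral_add ((hi u).const_mul s) ((hi v).const_mul t)]
    refine integral_mono_ae (hi _) (((hi u).const_mul s).add ((hi v).const_mul t)) ?_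
    filter_upwards [hf.convex, Lp.coeFn_add (s • u.1) (t • v.1), Lp.coeFn_add (s • u.2) (t • v.2),
      Lp.coeFn_smul s u.1, Lp.coeFn_smul s u.2, Lp.coeFn_smul t v.1, Lp.coeFn_smul t v.2]
      with x hx h1 h2 h3 h4 h5 h6
    have h := hx.2 (mem_univ (u.1 x, u.2 x)) (mem_univ (v.1 x, v.2 x)) hs ht hst
    simp only [Prod.fst_add, Prod.snd_add, Prod.smul_fst, Prod.smul_snd, h1, h2, Pi.add_apply, h3,
      h4, h5, h6, Pi.smul_apply]
    simpa using h
  refine ⟨hconv, ?_⟩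
  obtain ⟨c₀, c₁, n₀, n₁, h0, h1, hn0, hn1, hb⟩ := hf.growth
  set G := fun z : Lp (Vec N) (ENNReal.ofReal p) μ × Lp (Vec N) (ENNReal.ofReal q) μ =>
    c₁ * (‖z.1‖ ^ p + ‖z.2‖ ^ q) + ∫ x, n₁ x ∂μ
  have hIG : ∀ z, I z ≤ G z := by
    intro z
    have e1 := (Lp.memLp z.1).integrable_rpow_ofReal hp
    have e2 := (Lp.memLp z.2).integrable_rpow_ofReal hq
    have e3 : Integrable (fun x => ‖z.1 x‖ ^ p + ‖z.2 x‖ ^ q) μ := e1.add e2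
    simp only [I, G]
    rw [Lp.norm_rpow_eq_integral hp, Lp.norm_rpow_eq_integral hq, ← integral_add e1 e2,
      ← integral_const_mul, ← integral_add (e3.const_mul c₁) hn1]
    exact integral_mono_ae (hi z) ((e3.const_mul c₁).add hn1) (hb.mono fun x hx => (hx _ _).2)
  have hG : Continuous G :=
    ((((continuous_norm.comp continuous_fst).rpow_const fun _ => Or.inr hp.le).add
      ((continuous_norm.comp continuous_snd).rpow_const fun _ => Or.inr hq.le)).const_mul c₁).add
      continuous_const
  have hbc : (∃ z₀ ∈ univ, IsBoundedUnder (· ≤ ·) (𝓝 z₀) I) → ContinuousOn I univ :=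
    ((hconv.continuousOn_tfae isOpen_univ univ_nonempty).out 3 1).1
  rw [← continuousOn_univ]
  refine hbc ⟨0, mem_univ _, G 0 + 1, ?_⟩
  rw [eventually_map]
  filter_upwards [(hG.tendsto 0).eventually (gt_mem_nhds (lt_add_one (G 0)))] with z hz
  exact (hIG z).trans hz.le

/-- **Duality** for integral functionals on a subspace `W` of `L^p × L^q`: the value of the
conjugate of the restriction to `W` is attained by the integral of the conjugate integrand. -/
theorem exists_dual (hf : IsGrowthIntegrand μ p q f) (hp : p.HolderConjugate p')
    (hq : q.HolderConjugate q') [IsFiniteMeasure μ]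
    (W : Submodule ℝ ((α → Vec N) × (α → Vec N)))
    (hW : ∀ w ∈ W, MemLp w.1 (ENNReal.ofReal p) μ ∧ MemLp w.2 (ENNReal.ofReal q) μ)
    {ξ₀ η₀ : α → Vec N} (hξ₀ : MemLp ξ₀ (ENNReal.ofReal p') μ)
    (hη₀ : MemLp η₀ (ENNReal.ofReal q') μ) {S : ℝ}
    (hS : ∀ w ∈ W, ∫ x, inner ℝ (w.1 x) (ξ₀ x) ∂μ + ∫ x, inner ℝ (w.2 x) (η₀ x) ∂μ -
      ∫ x, f x (w.1 x) (w.2 x) ∂μ ≤ S) :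
    ∃ ξ η : α → Vec N, MemLp ξ (ENNReal.ofReal p') μ ∧ MemLp η (ENNReal.ofReal q') μ ∧
      (∀ w ∈ W, ∫ x, inner ℝ (w.1 x) (ξ x) ∂μ + ∫ x, inner ℝ (w.2 x) (η x) ∂μ =
        ∫ x, inner ℝ (w.1 x) (ξ₀ x) ∂μ + ∫ x, inner ℝ (w.2 x) (η₀ x) ∂μ) ∧
      ∫ x, conj (f x) (ξ x) (η x) ∂μ ≤ S := by
  have : Fact (1 ≤ ENNReal.ofReal p) := ⟨by simpa using hp.lt.le⟩
  have : Fact (1 ≤ ENNReal.ofReal q) := ⟨by simpa using hq.lt.le⟩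
  set X := Lp (Vec N) (ENNReal.ofReal p) μ × Lp (Vec N) (ENNReal.ofReal q) μ
  have hint1 : ∀ u : Lp (Vec N) (ENNReal.ofReal p) μ,
      Integrable (fun x => inner ℝ (u x) (ξ₀ x)) μ :=
    fun u => (Lp.memLp u).integrable_inner_of_holderConjugate hp hξ₀
  have hint2 : ∀ u : Lp (Vec N) (ENNReal.ofReal q) μ,
      Integrable (fun x => inner ℝ (u x) (η₀ x)) μ :=
    fun u => (Lp.memLp u).integrable_inner_of_holderConjugate hq hη₀
  let lin1 : Lp (Vec N) (ENNReal.ofReal p) μ →ₗ[ℝ] ℝ :=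
    { toFun := fun u => ∫ x, inner ℝ (u x) (ξ₀ x) ∂μ
      map_add' := fun u v => by
        rw [← integral_add (hint1 u) (hint1 v)]
        refine integral_congr_ae ?_
        filter_upwards [Lp.coeFn_add u v] with x hx
        rw [hx, Pi.add_apply, inner_add_left]
      map_smul' := fun t u => by
        rw [RingHom.id_apply, smul_eq_mul, ← integral_const_mul]
        refine integral_congr_ae ?_
        filter_upwards [Lp.coeFn_smul t u] with x hx
        rw [hx, Pi.smul_apply, real_inner_smul_left] }
  let lin2 : Lp (Vec N) (ENNReal.ofReal q) μ →ₗ[ℝ] ℝ :=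
    { toFun := fun u => ∫ x, inner ℝ (u x) (η₀ x) ∂μ
      map_add' := fun u v => by
        rw [← integral_add (hint2 u) (hint2 v)]
        refine integral_congr_ae ?_
        filter_upwards [Lp.coeFn_add u v] with x hx
        rw [hx, Pi.add_apply, inner_add_left]
      map_smul' := fun t u => by
        rw [RingHom.id_apply, smul_eq_mul, ← integral_const_mul]
        refine integral_congr_ae ?_
        filter_upwards [Lp.coeFn_smul t u] with x hx
        rw [hx, Pi.smul_apply, real_inner_smul_left] }
  -- The members of `W` are functions; the separation argument needs their classes.
  let W' : Submodule ℝ X :=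
    { carrier := {z | ∃ w ∈ W, z.1 =ᵐ[μ] w.1 ∧ z.2 =ᵐ[μ] w.2}
      zero_mem' := ⟨0, W.zero_mem, Lp.coeFn_zero _ _ _, Lp.coeFn_zero _ _ _⟩
      add_mem' := by
        rintro a b ⟨w, hw, h1, h2⟩ ⟨w', hw', h1', h2'⟩
        exact ⟨w + w', W.add_mem hw hw', (Lp.coeFn_add _ _).trans (h1.add h1'),
          (Lp.coeFn_add _ _).trans (h2.add h2')⟩
      smul_mem' := by
        rintro t a ⟨w, hw, h1, h2⟩
        exact ⟨t • w, W.smul_mem t hw, (Lp.coeFn_smul _ _).trans (h1.const_smul t),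
          (Lp.coeFn_smul _ _).trans (h2.const_smul t)⟩ }
  have hcongr : ∀ {a b c : α → Vec N}, a =ᵐ[μ] b →
      ∫ x, inner ℝ (a x) (c x) ∂μ = ∫ x, inner ℝ (b x) (c x) ∂μ := fun h =>
    integral_congr_ae (h.mono fun x hx => by simp only [hx])
  obtain ⟨hconv, hcont⟩ := hf.continuous_integral hp.pos hq.pos
  -- The functional extended from `W'` is the pairing with `(ξ₀, η₀)`, so the new fields agree with
  -- these only on `W`, but now satisfy the bound by `S` against every pair.
  obtain ⟨ℓ, hℓW, hℓ⟩ := exists_clm_eqOn_submodule_forall_sub_le hconv hcont W'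
    (lin1.coprod lin2) (S := S) (by
      rintro z ⟨w, hw, h1, h2⟩
      have e1 := hS w hw
      rw [← hcongr h1, ← hcongr h2] at e1
      have e2 : ∫ x, f x (z.1 x) (z.2 x) ∂μ = ∫ x, f x (w.1 x) (w.2 x) ∂μ := by
        refine integral_congr_ae ?_
        filter_upwards [h1, h2] with x hx1 hx2
        rw [hx1, hx2]
      rw [← e2] at e1
      exact e1)
  obtain ⟨ξ, hξ, hξ'⟩ := Lp.exists_forall_eq_integral_inner hp
    (ℓ.comp (ContinuousLinearMap.inl ℝ _ _))
  obtain ⟨η, hη, hη'⟩ := Lp.exists_forall_eq_integral_inner hq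
    (ℓ.comp (ContinuousLinearMap.inr ℝ _ _))
  have hℓ' : ∀ z : X, ℓ z = ∫ x, inner ℝ (z.1 x) (ξ x) ∂μ + ∫ x, inner ℝ (z.2 x) (η x) ∂μ := by
    intro z
    rw [← hξ', ← hη', ContinuousLinearMap.comp_apply, ContinuousLinearMap.comp_apply, ← map_add]
    simp
  refine ⟨ξ, η, hξ, hη, fun w hw => ?_, hf.integral_conj_le hp hq hξ hη fun u w hu hw => ?_⟩
  · obtain ⟨hw1, hw2⟩ := hW w hw
    have h := hℓW (hw1.toLp, hw2.toLp) ⟨w, hw, hw1.coeFn_toLp, hw2.coeFn_toLp⟩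
    rw [hℓ'] at h
    rw [← hcongr hw1.coeFn_toLp, ← hcongr hw2.coeFn_toLp, h]
    simp only [LinearMap.coprod_apply]
    rw [← hcongr (c := ξ₀) hw1.coeFn_toLp, ← hcongr (c := η₀) hw2.coeFn_toLp]
    rfl
  · have h := hℓ (hu.toLp, hw.toLp)
    rw [hℓ', hcongr hu.coeFn_toLp, hcongr hw.coeFn_toLp] at h
    have e2 : ∫ x, f x (hu.toLp u x) (hw.toLp w x) ∂μ = ∫ x, f x (u x) (w x) ∂μ := by
      refine integral_congr_ae ?_
      filter_upwards [hu.coeFn_toLp, hw.coeFn_toLp] with x hx1 hx2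
      rw [hx1, hx2]
    rw [e2] at h
    exact h

end IsGrowthIntegrand

end PeriodicCell

/-! ### The period lattice and integrals of periodic functions. -/

namespace PeriodicCell

open Filter Topology
open scoped Pointwise

variable {N : ℕ} (x₀ : Vec N) (v : Module.Basis (Fin N) ℝ (Vec N))

/-- The period lattice of the cell. -/
abbrev periodLattice : Submodule ℤ (Vec N) := Submodule.span ℤ (range v)

instance : VAddInvariantMeasure (periodLattice v) (Vec N) volume :=
  ⟨fun c s _ => measure_preimage_add volume (c : Vec N) s⟩

theorem isOpen_cell : IsOpen (cell x₀ v) := by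
  have h : cell x₀ v = ⋂ i, {x | v.repr (x - x₀) i ∈ Ioo (0 : ℝ) 1} := by
    ext x; simp [cell]
  rw [h]
  refine isOpen_iInter_of_finite fun i => ?_
  have hc : Continuous fun x : Vec N => v.repr (x - x₀) i :=
    (LinearMap.continuous_of_finiteDimensional (v.coord i)).comp (continuous_sub_right x₀)
  exact isOpen_Ioo.preimage hc

theorem measurableSet_cell : MeasurableSet (cell x₀ v) := (isOpen_cell x₀ v).measurableSet

theorem sub_mem_fundamentalDomain {x : Vec N} (hx : x ∈ cell x₀ v) :
    x - x₀ ∈ ZSpan.fundamentalDomain v := by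
  rw [ZSpan.mem_fundamentalDomain]
  exact fun i => ⟨(hx i).1.le, (hx i).2⟩

theorem isBounded_cell : Bornology.IsBounded (cell x₀ v) := by
  obtain ⟨R, hR⟩ := (ZSpan.fundamentalDomain_isBounded v).subset_closedBall 0
  refine (Metric.isBounded_closedBall (x := x₀) (r := R)).subset fun x hx => ?_
  have := hR (sub_mem_fundamentalDomain x₀ v hx)
  rw [mem_closedBall_zero_iff] at this
  rwa [Metric.mem_closedBall, dist_eq_norm]

theorem cell_nonempty : (cell x₀ v).Nonempty := by
  refine ⟨x₀ + v.equivFun.symm (fun _ => 1 / 2), fun i => ?_⟩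
  have : v.repr (v.equivFun.symm fun _ => (1 / 2 : ℝ)) i = 1 / 2 := by
    rw [← v.equivFun_apply, LinearEquiv.apply_symm_apply]
  rw [add_sub_cancel_left, this]
  norm_num

theorem volume_cell_pos : 0 < volume (cell x₀ v) :=
  (isOpen_cell x₀ v).measure_pos _ (cell_nonempty x₀ v)

instance isFiniteMeasure_restrict_cell : IsFiniteMeasure (volume.restrict (cell x₀ v)) :=
  ⟨by rw [Measure.restrict_apply_univ]; exact (isBounded_cell x₀ v).measure_lt_top⟩

instance neZero_restrict_cell : NeZero (volume.restrict (cell x₀ v)) :=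
  ⟨fun h => (volume_cell_pos x₀ v).ne' (Measure.restrict_eq_zero.1 h)⟩

/-- The translates of the open cell miss only countably many hyperplanes of measure zero, and they
are disjoint because representatives in the half-open parallelepiped are unique. -/
theorem isAddFundamentalDomain_cell :
    IsAddFundamentalDomain (periodLattice v) (cell x₀ v) volume where
  nullMeasurableSet := (measurableSet_cell x₀ v).nullMeasurableSet
  ae_covers := by
    have hnull : ∀ i, ∀ n : ℤ, ∀ᵐ x : Vec N, v.repr (x - x₀) i ≠ n := by
      intro i n
      have h0 : volume ((LinearMap.ker (v.coord i) : Submodule ℝ (Vec N)) : Set (Vec N)) = 0 := by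
        refine Measure.addHaar_submodule _ _ fun h => ?_
        have : v i ∈ LinearMap.ker (v.coord i) := by rw [h]; trivial
        simp at this
      rw [ae_iff]
      have h1 : {x : Vec N | ¬ v.repr (x - x₀) i ≠ n} =
          (fun x => x + (-(x₀ + (n : ℝ) • v i))) ⁻¹' (LinearMap.ker (v.coord i)) := by
        ext x
        simp only [ne_eq, not_not, mem_ofPred_eq, mem_preimage, SetLike.mem_coe, LinearMap.mem_ker,
          Module.Basis.coord_apply, map_add, map_neg, map_sub, map_smul, Module.Basis.repr_self,
          Finsupp.single_eq_same, smul_eq_mul, mul_one, Finsupp.coe_sub,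
          Pi.sub_apply]
        constructor <;> intro h <;> linarith
      rw [h1, measure_preimage_add_right, h0]
    filter_upwards [ae_all_iff.2 fun i => ae_all_iff.2 (hnull i)] with x hx
    -- Subtracting the integer parts leaves the fractional parts, which are strictly positive off
    -- the exceptional hyperplanes.
    refine ⟨-ZSpan.floor v (x - x₀), fun i => ?_⟩
    rw [Submodule.vadd_def, vadd_eq_add]
    have h1 : ((-ZSpan.floor v (x - x₀) : periodLattice v) : Vec N) + x - x₀ =
        ZSpan.fract v (x - x₀) := by
      rw [ZSpan.fract_apply, Submodule.coe_neg]; abel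
    rw [h1, ZSpan.repr_fract_apply]
    refine ⟨(Int.fract_nonneg _).lt_of_ne fun h => ?_, Int.fract_lt_one _⟩
    obtain ⟨n, hn⟩ := Int.fract_eq_zero_iff.1 h.symm
    exact hx i n hn.symm
  aedisjoint := by
    intro g h hgh
    refine Disjoint.aedisjoint ?_
    rw [Set.disjoint_left]
    rintro x ⟨y, hy, rfl⟩ ⟨z, hz, hyz⟩
    apply hgh
    obtain ⟨w, -, hw⟩ := ZSpan.exist_unique_vadd_mem_fundamentalDomain v (g +ᵥ y - x₀)
    have e1 := hw (-g) (by
      convert sub_mem_fundamentalDomain x₀ v hy using 1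
      simp only [Submodule.vadd_def, vadd_eq_add, Submodule.coe_neg]; abel)
    have e2 := hw (-h) (by
      convert sub_mem_fundamentalDomain x₀ v hz using 1
      simp only [Submodule.vadd_def, vadd_eq_add, Submodule.coe_neg] at hyz ⊢
      rw [← add_sub_assoc, ← hyz]; abel)
    exact neg_injective (e1.trans e2.symm)

variable {β : Type*}

theorem periodic_vadd {f : Vec N → β} (hf : ∀ i x, f (x + v i) = f x) (g : periodLattice v)
    (x : Vec N) : f (g +ᵥ x) = f x := by
  obtain ⟨g, hg⟩ := g
  rw [Submodule.vadd_def, vadd_eq_add]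
  change f (g + x) = f x
  induction hg using Submodule.span_induction generalizing x with
  | mem y hy => obtain ⟨i, rfl⟩ := hy; rw [add_comm, hf]
  | zero => rw [zero_add]
  | add y z _ _ hy hz => rw [add_assoc, hy, hz]
  | smul n y _ hy =>
    induction n using Int.induction_on generalizing x with
    | zero => simp
    | succ n ih => rw [add_smul, one_smul, add_assoc, ih, hy]
    | pred n ih => rw [sub_smul, one_smul, sub_add_eq_add_sub, add_sub_assoc, ih, ← hy, add_sub_cancel]

theorem preimage_add_cell (h : Vec N) : (fun x => x + h) ⁻¹' cell (x₀ + h) v = cell x₀ v := by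
  ext x
  simp only [cell, mem_preimage, mem_ofPred_eq]
  rw [add_sub_add_right_eq_sub]

theorem measurePreserving_add_cell (h : Vec N) :
    MeasurePreserving (fun x => x + h) (volume.restrict (cell x₀ v))
      (volume.restrict (cell (x₀ + h) v)) := by
  have := (measurePreserving_add_right (volume : Measure (Vec N)) h).restrict_preimage
    (measurableSet_cell (x₀ + h) v)
  rwa [preimage_add_cell] at this

variable {E : Type*} [NormedAddCommGroup E]

theorem aestronglyMeasurable_of_periodic {f : Vec N → E} (hf : ∀ i x, f (x + v i) = f x)
    (hm : AEStronglyMeasurable f (volume.restrict (cell x₀ v))) :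
    AEStronglyMeasurable f volume := by
  have hD := isAddFundamentalDomain_cell x₀ v
  rw [← hD.sum_restrict, aestronglyMeasurable_sum_measure_iff]
  exact fun g => (hD.aestronglyMeasurable_on_iff (hD.vadd g) (periodic_vadd v hf)).1 hm

/-- The translated cell is another fundamental domain of the same lattice. -/
theorem setLIntegral_cell_add {f : Vec N → ENNReal} (hf : ∀ i x, f (x + v i) = f x)
    (h : Vec N) :
    ∫⁻ x in cell x₀ v, f (x + h) = ∫⁻ x in cell x₀ v, f x := by
  have h1 := (measurePreserving_add_cell x₀ v h).lintegral_comp_emb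
    (measurableEmbedding_addRight h) f
  rw [h1]
  exact (isAddFundamentalDomain_cell (x₀ + h) v).setLIntegral_eq
    (isAddFundamentalDomain_cell x₀ v) f (periodic_vadd v hf)

theorem setIntegral_cell_add [NormedSpace ℝ E] {f : Vec N → E} (hf : ∀ i x, f (x + v i) = f x)
    (h : Vec N) :
    ∫ x in cell x₀ v, f (x + h) = ∫ x in cell x₀ v, f x := by
  have h1 := (measurePreserving_add_cell x₀ v h).integral_comp
    (measurableEmbedding_addRight h) f
  rw [h1]
  exact (isAddFundamentalDomain_cell (x₀ + h) v).setIntegral_eq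
    (isAddFundamentalDomain_cell x₀ v) (periodic_vadd v hf)

theorem eLpNorm_cell_add {f : Vec N → E} (hf : ∀ i x, f (x + v i) = f x) {r : ℝ} (hr : 0 < r)
    (h : Vec N) :
    eLpNorm (fun x => f (x + h)) (ENNReal.ofReal r) (volume.restrict (cell x₀ v)) =
      eLpNorm f (ENNReal.ofReal r) (volume.restrict (cell x₀ v)) := by
  have hr0 : ENNReal.ofReal r ≠ 0 := by simpa using hr
  rw [eLpNorm_eq_lintegral_rpow_enorm_toReal hr0 ENNReal.ofReal_ne_top,
    eLpNorm_eq_lintegral_rpow_enorm_toReal hr0 ENNReal.ofReal_ne_top]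
  rw [setLIntegral_cell_add x₀ v (f := fun x => ‖f x‖ₑ ^ (ENNReal.ofReal r).toReal)
    (fun i x => by simp only [hf])]

/-- `n` counts the lattice translates of `K` that meet the cell, finitely many since the lattice is
discrete; it does not depend on `f`. -/
theorem exists_setLIntegral_le_of_periodic {K : Set (Vec N)} (hK : Bornology.IsBounded K) :
    ∃ n : ℕ, ∀ f : Vec N → ENNReal, (∀ i x, f (x + v i) = f x) →
      ∫⁻ x in K, f x ≤ n * ∫⁻ x in cell x₀ v, f x := by
  classical
  have hD := isAddFundamentalDomain_cell x₀ v
  set T : Set (periodLattice v) := {g | ((g +ᵥ K) ∩ cell x₀ v).Nonempty}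
  have hfin : T.Finite := by
    obtain ⟨R, hR⟩ := hK.subset_closedBall 0
    obtain ⟨R', hR'⟩ := (isBounded_cell x₀ v).subset_closedBall 0
    have h1 := ZSpan.setFinite_inter v (Metric.isBounded_closedBall (x := (0 : Vec N)) (r := R + R'))
    refine (h1.preimage Subtype.val_injective.injOn).subset ?_
    rintro g ⟨_, ⟨y, hy, rfl⟩, hgy⟩
    refine ⟨?_, g.2⟩
    have e1 := hR hy
    have e2 := hR' hgy
    rw [mem_closedBall_zero_iff] at e1 e2 ⊢
    simp only [vadd_eq_add] at e2
    calc ‖(g : Vec N)‖ = ‖((g : Vec N) + y) - y‖ := by rw [add_sub_cancel_right]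
      _ ≤ ‖(g : Vec N) + y‖ + ‖y‖ := norm_sub_le _ _
      _ ≤ R + R' := by linarith
  refine ⟨hfin.toFinset.card, fun f hf => ?_⟩
  rw [hD.setLIntegral_eq_tsum', tsum_eq_sum (s := hfin.toFinset)]
  · calc _ ≤ ∑ _g ∈ hfin.toFinset, ∫⁻ x in cell x₀ v, f x := by
          refine Finset.sum_le_sum fun g _ => ?_
          simp only [periodic_vadd v hf]
          exact lintegral_mono_set inter_subset_right
      _ = _ := by rw [Finset.sum_const, nsmul_eq_mul]
  · intro g hg
    have : (g +ᵥ K) ∩ cell x₀ v = ∅ := by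
      rw [← not_nonempty_iff_eq_empty]
      exact fun h => hg (hfin.mem_toFinset.2 h)
    rw [this, Measure.restrict_empty, lintegral_zero_measure]

theorem locallyIntegrable_of_periodic {f : Vec N → E} (hf : ∀ i x, f (x + v i) = f x)
    (hi : IntegrableOn f (cell x₀ v)) : LocallyIntegrable f volume := by
  rw [locallyIntegrable_iff]
  intro K hK
  obtain ⟨n, hn⟩ := exists_setLIntegral_le_of_periodic x₀ v hK.isBounded
  refine ⟨(aestronglyMeasurable_of_periodic x₀ v hf hi.1).restrict, ?_⟩
  have h := hn (fun x => ‖f x‖ₑ) (fun i x => by simp only [hf])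
  exact h.trans_lt (ENNReal.mul_lt_top (ENNReal.natCast_lt_top n) hi.2)

/-- The representative of `x` modulo the period lattice in the half-open cell. -/
noncomputable def foldCell (x : Vec N) : Vec N := x₀ + ZSpan.fract v (x - x₀)

theorem foldCell_add (i : Fin N) (x : Vec N) : foldCell x₀ v (x + v i) = foldCell x₀ v x := by
  rw [foldCell, foldCell, add_sub_right_comm,
    ZSpan.fract_add_ZSpan v _ (Submodule.subset_span (mem_range_self i))]

theorem foldCell_eq_self {x : Vec N} (hx : x ∈ cell x₀ v) : foldCell x₀ v x = x := by
  rw [foldCell, ZSpan.fract_eq_self.2 (sub_mem_fundamentalDomain x₀ v hx), add_sub_cancel]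

/-- This is how a class in `L^r` of the cell gets a periodic representative on the whole space. -/
theorem comp_foldCell_ae_eq {β : Type*} (f : Vec N → β) :
    (fun x => f (foldCell x₀ v x)) =ᵐ[volume.restrict (cell x₀ v)] f := by
  filter_upwards [ae_restrict_mem (measurableSet_cell x₀ v)] with x hx
  rw [foldCell_eq_self x₀ v hx]

end PeriodicCell

/-! ### Minkowski's integral inequality. -/

section Minkowski

/-- Minkowski's integral inequality for averages. -/
theorem eLpNorm_integral_le {α T E : Type*} [MeasurableSpace α] [MeasurableSpace T]
    [NormedAddCommGroup E] [NormedSpace ℝ E] {μ : Measure α} {τ : Measure T} [SFinite μ]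
    [IsProbabilityMeasure τ] {k : α → T → E} (hk : AEStronglyMeasurable (Function.uncurry k) (μ.prod τ))
    {r : ℝ} (hr : 1 ≤ r) {B : ENNReal}
    (hB : ∀ᵐ t ∂τ, eLpNorm (fun x => k x t) (ENNReal.ofReal r) μ ≤ B) :
    eLpNorm (fun x => ∫ t, k x t ∂τ) (ENNReal.ofReal r) μ ≤ B := by
  have hr0 : 0 < r := by linarith
  have hne : ENNReal.ofReal r ≠ 0 := by simpa using hr0
  -- Because `τ` is a probability measure, power means increase with the exponent; Tonelli then
  -- finishes.
  have h1 : ∀ᵐ x ∂μ, ‖∫ t, k x t ∂τ‖ₑ ^ r ≤ ∫⁻ t, ‖k x t‖ₑ ^ r ∂τ := by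
    filter_upwards [hk.prodMk_left] with x hx
    have h2 : ‖∫ t, k x t ∂τ‖ₑ ≤ (∫⁻ t, ‖k x t‖ₑ ^ r ∂τ) ^ (1 / r) := by
      refine (enorm_integral_le_lintegral_enorm _).trans ?_
      have h3 := eLpNorm_le_eLpNorm_of_exponent_le (μ := τ) (f := k x) (p := 1)
        (q := ENNReal.ofReal r) (by simpa using hr) hx
      rwa [eLpNorm_one_eq_lintegral_enorm,
        eLpNorm_eq_lintegral_rpow_enorm_toReal hne ENNReal.ofReal_ne_top,
        ENNReal.toReal_ofReal hr0.le] at h3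
    calc _ ≤ ((∫⁻ t, ‖k x t‖ₑ ^ r ∂τ) ^ (1 / r)) ^ r := ENNReal.rpow_le_rpow h2 hr0.le
      _ = _ := by rw [← ENNReal.rpow_mul, one_div_mul_cancel hr0.ne', ENNReal.rpow_one]
  have h2 : ∀ᵐ t ∂τ, ∫⁻ x, ‖k x t‖ₑ ^ r ∂μ ≤ B ^ r := by
    filter_upwards [hB] with t ht
    rw [eLpNorm_eq_lintegral_rpow_enorm_toReal hne ENNReal.ofReal_ne_top,
      ENNReal.toReal_ofReal hr0.le] at ht
    calc _ = ((∫⁻ x, ‖k x t‖ₑ ^ r ∂μ) ^ (1 / r)) ^ r := by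
          rw [← ENNReal.rpow_mul, one_div_mul_cancel hr0.ne', ENNReal.rpow_one]
      _ ≤ _ := ENNReal.rpow_le_rpow ht hr0.le
  rw [eLpNorm_eq_lintegral_rpow_enorm_toReal hne ENNReal.ofReal_ne_top,
    ENNReal.toReal_ofReal hr0.le]
  calc (∫⁻ x, ‖∫ t, k x t ∂τ‖ₑ ^ r ∂μ) ^ (1 / r)
      ≤ (∫⁻ x, ∫⁻ t, ‖k x t‖ₑ ^ r ∂τ ∂μ) ^ (1 / r) :=
        ENNReal.rpow_le_rpow (lintegral_mono_ae h1) (by positivity)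
    _ = (∫⁻ t, ∫⁻ x, ‖k x t‖ₑ ^ r ∂μ ∂τ) ^ (1 / r) := by
        rw [lintegral_lintegral_swap]
        exact hk.enorm.pow_const r
    _ ≤ (∫⁻ _t, B ^ r ∂τ) ^ (1 / r) :=
        ENNReal.rpow_le_rpow (lintegral_mono_ae h2) (by positivity)
    _ = B := by
        rw [lintegral_const, measure_univ, mul_one, ← ENNReal.rpow_mul,
          mul_one_div_cancel hr0.ne', ENNReal.rpow_one]

end Minkowski

/-! ### Weak gradients and increments along segments. -/

namespace PeriodicCell

open Filter Topology

variable {N : ℕ}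

section Translation

instance isProbabilityMeasure_restrict_Icc :
    IsProbabilityMeasure ((volume : Measure ℝ).restrict (Icc 0 1)) :=
  ⟨by simp⟩

/-- Transports measurability and integrability, known only almost everywhere in `x`, to the joint
variable `(t, x)` along `x + t • h`; Fubini on segments depends on it. -/
theorem measurePreserving_shear (h : Vec N) :
    MeasurePreserving (fun z : ℝ × Vec N => (z.1, z.2 + z.1 • h))
      ((volume.restrict (Icc 0 1)).prod volume) ((volume.restrict (Icc 0 1)).prod volume) :=
  (MeasurePreserving.id _).skew_product (g := fun t x => x + t • h) (by fun_prop)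
    (Eventually.of_forall fun t => (measurePreserving_add_right volume (t • h)).map_eq)

theorem integrable_mul_comp_sub_smul {g ψ : Vec N → ℝ} (hg : LocallyIntegrable g volume)
    (hψ : Continuous ψ) (hψc : HasCompactSupport ψ) (h : Vec N) :
    Integrable (fun z : ℝ × Vec N => g z.2 * ψ (z.2 - z.1 • h))
      ((volume.restrict (Icc 0 1)).prod volume) := by
  obtain ⟨M, hM⟩ := hψ.bounded_above_of_compact_support hψc
  -- The compact set swept by the support of `ψ`, outside which all the translates vanish.
  set K : Set (Vec N) := (fun z : ℝ × Vec N => z.2 + z.1 • h) '' (Icc 0 1 ×ˢ tsupport ψ)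
  have hK : IsCompact K := (isCompact_Icc.prod hψc).image (by fun_prop)
  have hdom : Integrable (fun z : ℝ × Vec N => M * ‖K.indicator g z.2‖)
      ((volume.restrict (Icc 0 1)).prod volume) := by
    have h1 : Integrable (K.indicator g) volume :=
      (integrable_indicator_iff hK.measurableSet).2 (hg.integrableOn_isCompact hK)
    exact (h1.norm.comp_snd _).const_mul M
  refine hdom.mono' ?_ ?_
  · exact hg.aestronglyMeasurable.comp_snd.mul (by fun_prop)
  · have hmem : ∀ᵐ z ∂((volume : Measure ℝ).restrict (Icc 0 1)).prod (volume : Measure (Vec N)),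
        z.1 ∈ Icc (0 : ℝ) 1 :=
      Measure.quasiMeasurePreserving_fst.ae (ae_restrict_mem measurableSet_Icc)
    filter_upwards [hmem] with z hz
    by_cases hzK : z.2 ∈ K
    · rw [indicator_of_mem hzK, norm_mul, mul_comm]
      exact mul_le_mul_of_nonneg_right (hM _) (norm_nonneg _)
    · have : ψ (z.2 - z.1 • h) = 0 := by
        by_contra hne
        exact hzK ⟨(z.1, z.2 - z.1 • h), ⟨hz, subset_tsupport _ hne⟩, by simp⟩
      rw [this, mul_zero, norm_zero, indicator_of_notMem hzK, norm_zero, mul_zero]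

theorem integrable_comp_add_smul_mul {g ψ : Vec N → ℝ} (hg : LocallyIntegrable g volume)
    (hψ : Continuous ψ) (hψc : HasCompactSupport ψ) (h : Vec N) :
    Integrable (fun z : ℝ × Vec N => g (z.2 + z.1 • h) * ψ z.2)
      ((volume.restrict (Icc 0 1)).prod volume) := by
  have h1 := (measurePreserving_shear h).integrable_comp_of_integrable
    (integrable_mul_comp_sub_smul hg hψ hψc h)
  simpa [Function.comp_def] using h1

theorem locallyIntegrable_integral_comp_add_smul {g : Vec N → ℝ}
    (hg : LocallyIntegrable g volume) (h : Vec N) :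
    LocallyIntegrable (fun x => ∫ t in Icc (0 : ℝ) 1, g (x + t • h)) volume := by
  rw [locallyIntegrable_iff]
  intro K hK
  obtain ⟨ψ, hψ1, -, hψc, -⟩ := exists_continuous_one_zero_of_isCompact hK isClosed_empty
    (disjoint_empty K)
  have h1 := (integrable_comp_add_smul_mul hg ψ.continuous hψc h).integral_prod_right
  refine (h1.integrableOn (s := K)).congr_fun (fun x hx => ?_) hK.measurableSet
  simp only
  rw [integral_mul_const, hψ1 hx, Pi.one_apply, mul_one]

theorem IsWeakGradient.integral_mul_fderiv {φ : Vec N → ℝ} {G : Vec N → Vec N}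
    (hw : IsWeakGradient φ G) (hφ : LocallyIntegrable φ volume) (hG : LocallyIntegrable G volume)
    {ψ : Vec N → ℝ} (hψ : ContDiff ℝ ∞ ψ) (hψc : HasCompactSupport ψ) (h : Vec N) :
    ∫ x, φ x * fderiv ℝ ψ x h = - ∫ x, inner ℝ (G x) h * ψ x := by
  have hd : ∀ e : Vec N, Integrable (fun x => φ x * fderiv ℝ ψ x e) volume := by
    intro e
    have hc : Continuous fun x => fderiv ℝ ψ x e :=
      (hψ.continuous_fderiv (by simp)).clm_apply continuous_const
    have := hφ.integrable_smul_left_of_hasCompactSupport hc (hψc.fderiv_apply ℝ e)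
    exact this.congr (Eventually.of_forall fun x => by simp [mul_comm])
  have hGi : ∀ i, Integrable (fun x => G x i * ψ x) volume := by
    intro i
    have := hG.integrable_smul_left_of_hasCompactSupport hψ.continuous hψc
    have h2 := (EuclideanSpace.proj i : Vec N →L[ℝ] ℝ).integrable_comp this
    exact h2.congr (Eventually.of_forall fun x => by simp [mul_comm])
  have hh : h = ∑ i, h i • EuclideanSpace.single i (1 : ℝ) := by
    ext j
    simp [Finset.sum_apply, Pi.single_apply]
  have e1 : ∀ x, φ x * fderiv ℝ ψ x h =
      ∑ i, h i * (φ x * fderiv ℝ ψ x (EuclideanSpace.single i 1)) := by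
    intro x
    conv_lhs => rw [hh]
    rw [map_sum, Finset.mul_sum]
    refine Finset.sum_congr rfl fun i _ => ?_
    rw [map_smul, smul_eq_mul]; ring
  have e2 : ∀ x, inner ℝ (G x) h * ψ x = ∑ i, h i * (G x i * ψ x) := by
    intro x
    rw [PiLp.inner_apply, Finset.sum_mul]
    refine Finset.sum_congr rfl fun i _ => ?_
    simp [mul_assoc]
  simp only [e1, e2]
  rw [integral_finsetSum _ fun i _ => (hd _).const_mul _,
    integral_finsetSum _ fun i _ => (hGi i).const_mul _, ← Finset.sum_neg_distrib]
  refine Finset.sum_congr rfl fun i _ => ?_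
  rw [integral_const_mul, integral_const_mul, hw ψ hψ hψc i, mul_neg]

/-- The increments of a weakly differentiable function are the integrals of its weak gradient
along segments. -/
theorem IsWeakGradient.ae_add_sub_eq_integral {φ : Vec N → ℝ} {G : Vec N → Vec N}
    (hw : IsWeakGradient φ G) (hφ : LocallyIntegrable φ volume) (hG : LocallyIntegrable G volume)
    (h : Vec N) :
    ∀ᵐ x : Vec N, φ (x + h) - φ x = ∫ t in Icc (0 : ℝ) 1, inner ℝ (G (x + t • h)) h := by
  set g : Vec N → ℝ := fun x => inner ℝ (G x) h
  have hg : LocallyIntegrable g volume := by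
    rw [locallyIntegrable_iff]
    intro K hK
    exact (hG.integrableOn_isCompact hK).inner_const h
  have hφh : LocallyIntegrable (fun x => φ (x + h)) volume := by
    rw [locallyIntegrable_iff]
    intro K hK
    have h1 := (measurePreserving_add_right (volume : Measure (Vec N)) h).integrableOn_comp_preimage
      (measurableEmbedding_addRight h) (f := φ) (s := (fun x => x + h) '' K)
    rw [preimage_image_eq _ (add_left_injective h)] at h1
    exact h1.2 (hφ.integrableOn_isCompact (hK.image (by fun_prop)))
  -- Tested against `ψ`, all translations move onto `ψ`, where the fundamental theorem of calculus
  -- is available. The weak gradient identity is used for each translate `ψ (· - t • h)`, and Fubini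
  -- exchanges `t` and `x`.
  refine ae_eq_of_integral_contDiff_smul_eq (hφh.sub hφ)
    (locallyIntegrable_integral_comp_add_smul hg h) fun ψ hψ hψc => ?_
  have hψ' : ContDiff ℝ ∞ ψ := hψ
  have hc : Continuous fun x => fderiv ℝ ψ x h :=
    (hψ'.continuous_fderiv (by simp)).clm_apply continuous_const
  have hψhc : HasCompactSupport fun x => ψ (x - h) :=
    hψc.comp_homeomorph (Homeomorph.subRight h)
  have i1 : Integrable (fun x => ψ x * φ (x + h)) volume :=
    hφh.integrable_smul_left_of_hasCompactSupport hψ'.continuous hψc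
  have i2 : Integrable (fun x => ψ x * φ x) volume :=
    hφ.integrable_smul_left_of_hasCompactSupport hψ'.continuous hψc
  have i3 : Integrable (fun x => ψ (x - h) * φ x) volume :=
    hφ.integrable_smul_left_of_hasCompactSupport (hψ'.continuous.comp (continuous_sub_right h)) hψhc
  have hftc : ∀ x, ψ (x - h) - ψ x = - ∫ t in Icc (0 : ℝ) 1, fderiv ℝ ψ (x - t • h) h := by
    intro x
    have hder : ∀ t : ℝ, HasDerivAt (fun t : ℝ => ψ (x - t • h)) (-(fderiv ℝ ψ (x - t • h) h)) t := by
      intro t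
      have h1 : HasDerivAt (fun t : ℝ => x - t • h) (-h) t := by
        simpa using ((hasDerivAt_id t).smul_const h).const_sub x
      have h2 := ((hψ'.differentiable (by simp)) (x - t • h)).hasFDerivAt.comp_hasDerivAt t h1
      rw [map_neg] at h2
      exact h2
    have h3 := intervalIntegral.integral_eq_sub_of_hasDerivAt (a := 0) (b := 1)
      (fun t _ => hder t)
      ((hc.comp (by fun_prop : Continuous fun t : ℝ => x - t • h)).neg.intervalIntegrable 0 1)
    rw [intervalIntegral.integral_of_le zero_le_one, ← integral_Icc_eq_integral_Ioc,
      integral_neg] at h3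
    simp only [one_smul, zero_smul, sub_zero] at h3
    exact h3.symm
  have hdiff : ∀ t : ℝ, ∫ x, φ x * fderiv ℝ ψ (x - t • h) h = - ∫ x, g x * ψ (x - t • h) := by
    intro t
    have h1 := hw.integral_mul_fderiv hφ hG (ψ := fun x => ψ (x - t • h))
      (hψ'.comp (by fun_prop)) (hψc.comp_homeomorph (Homeomorph.subRight (t • h))) h
    simpa only [fderiv_comp_sub] using h1
  have s1 := integral_integral_swap (f := fun (t : ℝ) (x : Vec N) =>
    φ x * fderiv ℝ ψ (x - t • h) h)
    (integrable_mul_comp_sub_smul hφ hc (hψc.fderiv_apply ℝ h) h)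
  have s2 := integral_integral_swap (f := fun (t : ℝ) (x : Vec N) => g (x + t • h) * ψ x)
    (integrable_comp_add_smul_mul hg hψ'.continuous hψc h)
  calc ∫ x, ψ x • (φ (x + h) - φ x)
      = (∫ x, ψ x * φ (x + h)) - ∫ x, ψ x * φ x := by
        rw [← integral_sub i1 i2]
        exact integral_congr_ae (Eventually.of_forall fun x => by simp [mul_sub])
    _ = (∫ x, ψ (x - h) * φ x) - ∫ x, ψ x * φ x := by
        rw [← integral_add_right_eq_self (fun x => ψ (x - h) * φ x) h]
        simp
    _ = ∫ x, -∫ t in Icc (0 : ℝ) 1, φ x * fderiv ℝ ψ (x - t • h) h := by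
        rw [← integral_sub i3 i2]
        refine integral_congr_ae (Eventually.of_forall fun x => ?_)
        simp only
        rw [← sub_mul, hftc, integral_const_mul]; ring
    _ = ∫ t in Icc (0 : ℝ) 1, ∫ x, g x * ψ (x - t • h) := by
        rw [integral_neg, ← s1, ← integral_neg]
        simp only [hdiff, neg_neg]
    _ = ∫ t in Icc (0 : ℝ) 1, ∫ x, g (x + t • h) * ψ x := by
        refine integral_congr_ae (Eventually.of_forall fun t => ?_)
        simp only
        rw [← integral_add_right_eq_self (fun x => g x * ψ (x - t • h)) (t • h)]
        simp
    _ = ∫ x, ψ x • ∫ t in Icc (0 : ℝ) 1, g (x + t • h) := by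
        rw [s2]
        refine integral_congr_ae (Eventually.of_forall fun x => ?_)
        simp only
        rw [integral_mul_const, smul_eq_mul, mul_comm]

end Translation

end PeriodicCell

/-! ### Periodic Sobolev functions: zero mean gradients and the Poincaré inequality. -/

namespace PeriodicCell

open Filter Topology

variable {N : ℕ} {x₀ : Vec N} {v : Module.Basis (Fin N) ℝ (Vec N)} {r : ℝ}

theorem integrable_cell_of_memLp {E : Type*} [NormedAddCommGroup E] (hr : 1 ≤ r) {f : Vec N → E}
    (hf : MemLp f (ENNReal.ofReal r) (volume.restrict (cell x₀ v))) :
    IntegrableOn f (cell x₀ v) :=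
  hf.integrable (by simpa using hr)

namespace IsPeriodicSobolev

variable {φ ψ : Vec N → ℝ} {G H : Vec N → Vec N}

theorem locallyIntegrable (h : IsPeriodicSobolev x₀ v r φ G) (hr : 1 ≤ r) :
    LocallyIntegrable φ volume :=
  locallyIntegrable_of_periodic x₀ v h.periodic (integrable_cell_of_memLp hr h.memLp)

theorem locallyIntegrable_grad (h : IsPeriodicSobolev x₀ v r φ G) (hr : 1 ≤ r) :
    LocallyIntegrable G volume :=
  locallyIntegrable_of_periodic x₀ v h.periodic_grad (integrable_cell_of_memLp hr h.memLp_grad)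

theorem integrable_mul_fderiv (h : IsPeriodicSobolev x₀ v r φ G) (hr : 1 ≤ r) {χ : Vec N → ℝ}
    (hχ : ContDiff ℝ ∞ χ) (hχc : HasCompactSupport χ) (e : Vec N) :
    Integrable (fun x => φ x * fderiv ℝ χ x e) volume := by
  have hc : Continuous fun x => fderiv ℝ χ x e :=
    (hχ.continuous_fderiv (by simp)).clm_apply continuous_const
  have := (h.locallyIntegrable hr).integrable_smul_left_of_hasCompactSupport hc
    (hχc.fderiv_apply ℝ e)
  exact this.congr (Eventually.of_forall fun x => by simp [mul_comm])

theorem integrable_grad_mul (h : IsPeriodicSobolev x₀ v r φ G) (hr : 1 ≤ r) {χ : Vec N → ℝ}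
    (hχ : Continuous χ) (hχc : HasCompactSupport χ) (i : Fin N) :
    Integrable (fun x => G x i * χ x) volume := by
  have := (h.locallyIntegrable_grad hr).integrable_smul_left_of_hasCompactSupport hχ hχc
  have h2 := (EuclideanSpace.proj i : Vec N →L[ℝ] ℝ).integrable_comp this
  exact h2.congr (Eventually.of_forall fun x => by simp [mul_comm])

theorem zero (x₀ : Vec N) (v : Module.Basis (Fin N) ℝ (Vec N)) (r : ℝ) :
    IsPeriodicSobolev x₀ v r (0 : Vec N → ℝ) (0 : Vec N → Vec N) where
  periodic _ _ := rfl
  periodic_grad _ _ := rfl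
  memLp := MemLp.zero
  memLp_grad := MemLp.zero
  weakGradient := fun χ _ _ i => by simp
  mean_zero := by simp

theorem add (h : IsPeriodicSobolev x₀ v r φ G) (h' : IsPeriodicSobolev x₀ v r ψ H) (hr : 1 ≤ r) :
    IsPeriodicSobolev x₀ v r (φ + ψ) (G + H) where
  periodic i x := by simp only [Pi.add_apply, h.periodic, h'.periodic]
  periodic_grad i x := by simp only [Pi.add_apply, h.periodic_grad, h'.periodic_grad]
  memLp := h.memLp.add h'.memLp
  memLp_grad := h.memLp_grad.add h'.memLp_grad
  weakGradient := fun χ hχ hχc i => by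
    have e1 := h.weakGradient χ hχ hχc i
    have e2 := h'.weakGradient χ hχ hχc i
    simp only [Pi.add_apply, PiLp.add_apply, add_mul]
    rw [integral_add (h.integrable_mul_fderiv hr hχ hχc _) (h'.integrable_mul_fderiv hr hχ hχc _),
      integral_add (h.integrable_grad_mul hr hχ.continuous hχc i)
        (h'.integrable_grad_mul hr hχ.continuous hχc i), e1, e2, neg_add]
  mean_zero := by
    simp only [Pi.add_apply]
    rw [integral_add (integrable_cell_of_memLp hr h.memLp) (integrable_cell_of_memLp hr h'.memLp),
      h.mean_zero, h'.mean_zero, add_zero]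

theorem smul (h : IsPeriodicSobolev x₀ v r φ G) (c : ℝ) :
    IsPeriodicSobolev x₀ v r (c • φ) (c • G) where
  periodic i x := by simp only [Pi.smul_apply, h.periodic]
  periodic_grad i x := by simp only [Pi.smul_apply, h.periodic_grad]
  memLp := h.memLp.const_smul c
  memLp_grad := h.memLp_grad.const_smul c
  weakGradient := fun χ hχ hχc i => by
    have e1 := h.weakGradient χ hχ hχc i
    simp only [Pi.smul_apply, PiLp.smul_apply, smul_eq_mul, mul_assoc]
    rw [integral_const_mul, integral_const_mul, e1, mul_neg]
  mean_zero := by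
    simp only [Pi.smul_apply, smul_eq_mul]
    rw [integral_const_mul, h.mean_zero, mul_zero]

theorem sub (h : IsPeriodicSobolev x₀ v r φ G) (h' : IsPeriodicSobolev x₀ v r ψ H) (hr : 1 ≤ r) :
    IsPeriodicSobolev x₀ v r (φ - ψ) (G - H) := by
  have := h.add (h'.smul (-1)) hr
  rwa [neg_one_smul, neg_one_smul, ← sub_eq_add_neg, ← sub_eq_add_neg] at this

theorem aestronglyMeasurable_grad_shear (h : IsPeriodicSobolev x₀ v r φ G) (w : Vec N) :
    AEStronglyMeasurable (fun z : Vec N × ℝ => inner ℝ (G (z.1 + z.2 • w)) w)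
      ((volume.restrict (cell x₀ v)).prod (volume.restrict (Icc (0 : ℝ) 1))) := by
  have hG := aestronglyMeasurable_of_periodic x₀ v h.periodic_grad h.memLp_grad.1
  have h1 : AEStronglyMeasurable (fun z : ℝ × Vec N => G z.2)
      ((volume.restrict (Icc (0 : ℝ) 1)).prod volume) := hG.comp_snd
  have h2 := h1.comp_measurePreserving (measurePreserving_shear w)
  have h3 := h2.comp_measurePreserving (Measure.measurePreserving_swap
    (μ := (volume : Measure (Vec N))) (ν := volume.restrict (Icc (0 : ℝ) 1)))
  have h4 := h3.mono_ac (Measure.AbsolutelyContinuous.prod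
    (Measure.restrict_le_self (s := cell x₀ v)).absolutelyContinuous
    (Measure.AbsolutelyContinuous.refl (volume.restrict (Icc (0 : ℝ) 1))))
  exact h4.inner_const

theorem setIntegral_inner_grad_add (h : IsPeriodicSobolev x₀ v r φ G) (hr : 1 ≤ r) (y w : Vec N) :
    ∫ x in cell x₀ v, inner ℝ (G (x + y)) w = inner ℝ (∫ x in cell x₀ v, G x) w := by
  rw [setIntegral_cell_add x₀ v (f := fun x => inner ℝ (G x) w)
    (fun i x => by simp only [h.periodic_grad])]
  rw [real_inner_comm, ← integral_inner (integrable_cell_of_memLp hr h.memLp_grad)]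
  simp only [real_inner_comm]

/-- Periodic gradients have mean zero. -/
theorem integral_grad_eq_zero (h : IsPeriodicSobolev x₀ v r φ G) (hr : 1 ≤ r) :
    ∫ x in cell x₀ v, G x = 0 := by
  have hGi := integrable_cell_of_memLp hr h.memLp_grad
  -- The increment of `φ` along a period vanishes. Integrated over the cell, its segment formula
  -- becomes `⟨∫ G, v i⟩`, by Fubini and translation invariance.
  have key : ∀ i, inner ℝ (∫ x in cell x₀ v, G x) (v i) = 0 := by
    intro i
    have h1 := h.weakGradient.ae_add_sub_eq_integral (h.locallyIntegrable hr)
      (h.locallyIntegrable_grad hr) (v i)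
    have h2 : ∫ x in cell x₀ v, ∫ t in Icc (0 : ℝ) 1, inner ℝ (G (x + t • v i)) (v i) = 0 := by
      refine integral_eq_zero_of_ae ?_
      filter_upwards [ae_restrict_of_ae h1] with x hx
      rw [← hx, h.periodic, sub_self, Pi.zero_apply]
    have hper : ∀ j x, (inner ℝ (G (x + v j)) (v i) : ℝ) = inner ℝ (G x) (v i) :=
      fun j x => by rw [h.periodic_grad]
    have hint : ∀ t : ℝ, IntegrableOn (fun x => inner ℝ (G (x + t • v i)) (v i)) (cell x₀ v) := by
      intro t
      have := locallyIntegrable_of_periodic x₀ v (f := fun x => (inner ℝ (G x) (v i) : ℝ)) hper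
        (hGi.inner_const (v i))
      have h3 := (measurePreserving_add_cell x₀ v (t • v i)).integrable_comp_emb
        (measurableEmbedding_addRight _) (g := fun x => inner ℝ (G x) (v i))
      refine h3.2 ((this.integrableOn_isCompact
        (isBounded_cell (x₀ + t • v i) v).isCompact_closure).mono_set subset_closure)
    have hnorm : ∀ t : ℝ, ∫ x in cell x₀ v, ‖(inner ℝ (G (x + t • v i)) (v i) : ℝ)‖ =
        ∫ x in cell x₀ v, ‖(inner ℝ (G x) (v i) : ℝ)‖ := fun t =>
      setIntegral_cell_add x₀ v (f := fun x => ‖(inner ℝ (G x) (v i) : ℝ)‖)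
        (fun j x => by simp only [hper]) _
    have hprod : Integrable (Function.uncurry fun (x : Vec N) (t : ℝ) =>
        (inner ℝ (G (x + t • v i)) (v i) : ℝ))
        ((volume.restrict (cell x₀ v)).prod (volume.restrict (Icc (0 : ℝ) 1))) := by
      refine (integrable_prod_iff' (h.aestronglyMeasurable_grad_shear (v i))).2
        ⟨Eventually.of_forall hint, ?_⟩
      simp only [hnorm]
      exact integrable_const _
    rw [integral_integral_swap hprod] at h2
    simp only [h.setIntegral_inner_grad_add hr] at h2
    simpa using h2
  have hz : ∀ w : Vec N, inner ℝ (∫ x in cell x₀ v, G x) w = 0 := by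
    intro w
    rw [← v.sum_repr w, inner_sum]
    exact Finset.sum_eq_zero fun i _ => by rw [real_inner_smul_right, key, mul_zero]
  exact inner_self_eq_zero.1 (hz _)

/-- Minkowski's inequality for the segment formula; all translates of `G` have the same norm on the
cell. -/
theorem eLpNorm_add_sub_le (h : IsPeriodicSobolev x₀ v r φ G) (hr : 1 ≤ r) (w : Vec N) :
    eLpNorm (fun x => φ (x + w) - φ x) (ENNReal.ofReal r) (volume.restrict (cell x₀ v)) ≤
      ENNReal.ofReal ‖w‖ * eLpNorm G (ENNReal.ofReal r) (volume.restrict (cell x₀ v)) := by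
  have h1 := h.weakGradient.ae_add_sub_eq_integral (h.locallyIntegrable hr)
    (h.locallyIntegrable_grad hr) w
  rw [eLpNorm_congr_ae (ae_restrict_of_ae h1)]
  refine eLpNorm_integral_le (h.aestronglyMeasurable_grad_shear w) hr
    (Eventually.of_forall fun t => ?_)
  calc eLpNorm (fun x => (inner ℝ (G (x + t • w)) w : ℝ)) (ENNReal.ofReal r)
        (volume.restrict (cell x₀ v))
      ≤ ENNReal.ofReal ‖w‖ * eLpNorm (fun x => G (x + t • w)) (ENNReal.ofReal r)
        (volume.restrict (cell x₀ v)) := by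
        refine eLpNorm_le_mul_eLpNorm_of_ae_le_mul (Eventually.of_forall fun x => ?_) _
        rw [mul_comm]
        exact norm_inner_le_norm _ _
    _ = _ := by rw [eLpNorm_cell_add x₀ v h.periodic_grad (by linarith)]

/-- **Poincaré inequality** on the periodicity cell. -/
theorem exists_eLpNorm_le (x₀ : Vec N) (v : Module.Basis (Fin N) ℝ (Vec N)) (hr : 1 ≤ r) :
    ∃ R : ℝ, ∀ (φ : Vec N → ℝ) (G : Vec N → Vec N), IsPeriodicSobolev x₀ v r φ G →
      eLpNorm φ (ENNReal.ofReal r) (volume.restrict (cell x₀ v)) ≤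
        ENNReal.ofReal R * eLpNorm G (ENNReal.ofReal r) (volume.restrict (cell x₀ v)) := by
  obtain ⟨R, hR⟩ := (isBounded_cell x₀ v).subset_closedBall 0
  refine ⟨R, fun φ G h => ?_⟩
  set μ := volume.restrict (cell x₀ v)
  set τ : Measure (Vec N) := (μ univ)⁻¹ • μ
  have hφm := aestronglyMeasurable_of_periodic x₀ v h.periodic h.memLp.1
  have hτ : τ ≪ (volume : Measure (Vec N)) :=
    Measure.AbsolutelyContinuous.smul_left Measure.restrict_le_self.absolutelyContinuous _
  have hμ : μ ≪ (volume : Measure (Vec N)) := Measure.restrict_le_self.absolutelyContinuous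
  have hφint : IntegrableOn φ (cell x₀ v) := integrable_cell_of_memLp hr h.memLp
  have hmean : ∀ x, ∫ w, φ (x + w) ∂τ = 0 := by
    intro x
    have h1 := setIntegral_cell_add x₀ v h.periodic x
    rw [h.mean_zero] at h1
    simp only [τ, integral_smul_measure]
    simp only [add_comm x]
    rw [h1, smul_zero]
  -- As every translate of `φ` has mean zero, `φ` is minus the average of its own increments, over
  -- shifts `w` in the cell with `‖w‖ ≤ R`.
  have hrep : ∀ x, ∫ w, (φ (x + w) - φ x) ∂τ = - φ x := by
    intro x
    rw [integral_sub ?_ (integrable_const _), hmean, integral_const]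
    · simp
    · have h2 : IntegrableOn (fun w => φ (x + w)) (cell x₀ v) := by
        have h3 := (measurePreserving_add_cell x₀ v x).integrable_comp_emb
          (measurableEmbedding_addRight _) (g := φ)
        have h4 := h3.2 (((h.locallyIntegrable hr).integrableOn_isCompact
          (isBounded_cell (x₀ + x) v).isCompact_closure).mono_set subset_closure)
        simp only [add_comm x]
        exact h4
      exact h2.smul_measure (ENNReal.inv_ne_top.2 (NeZero.ne _))
  have hk : AEStronglyMeasurable (Function.uncurry fun x w => φ (x + w) - φ x) (μ.prod τ) := by
    have h1 : AEStronglyMeasurable (fun z : Vec N × Vec N => φ (z.1 + z.2))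
        ((volume : Measure (Vec N)).prod volume) :=
      hφm.comp_quasiMeasurePreserving (quasiMeasurePreserving_add volume volume)
    exact (h1.mono_ac (hμ.prod hτ)).sub h.memLp.1.comp_fst
  have hmain := eLpNorm_integral_le (μ := μ) (τ := τ) hk hr
    (B := ENNReal.ofReal R * eLpNorm G (ENNReal.ofReal r) μ) ?_
  · simp only [hrep] at hmain
    rwa [← eLpNorm_neg]
  · have hmem : ∀ᵐ w ∂τ, w ∈ cell x₀ v :=
      (Measure.AbsolutelyContinuous.smul_left (Measure.AbsolutelyContinuous.refl μ) _).ae_le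
        (ae_restrict_mem (measurableSet_cell x₀ v))
    filter_upwards [hmem] with w hw
    refine (h.eLpNorm_add_sub_le hr w).trans ?_
    gcongr
    exact mem_closedBall_zero_iff.1 (hR hw)

end IsPeriodicSobolev

end PeriodicCell

/-! ### Closedness of periodic gradients and their orthogonality to solenoidal fields. -/

/-- A point outside a closed subspace is separated from it by a continuous functional. -/
theorem Submodule.exists_clm_eq_zero_of_notMem_of_isClosed {X : Type*} [NormedAddCommGroup X]
    [NormedSpace ℝ X] {D : Submodule ℝ X} (hD : IsClosed (D : Set X)) {x : X} (hx : x ∉ D) :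
    ∃ ℓ : X →L[ℝ] ℝ, (∀ d ∈ D, ℓ d = 0) ∧ ℓ x ≠ 0 := by
  obtain ⟨ℓ, s, hs, hsx⟩ := geometric_hahn_banach_closed_point D.convex hD hx
  have h0 : 0 < s := by simpa using hs 0 D.zero_mem
  refine ⟨ℓ, fun d hd => ?_, (h0.trans hsx).ne'⟩
  by_contra hne
  have h := hs ((s / ℓ d) • d) (D.smul_mem _ hd)
  rw [map_smul, smul_eq_mul, div_mul_cancel₀ _ hne] at h
  exact lt_irrefl _ h

namespace PeriodicCell

open Filter Topology

variable {N : ℕ} {x₀ : Vec N} {v : Module.Basis (Fin N) ℝ (Vec N)} {r : ℝ}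

theorem tendsto_eLpNorm_one_cell {E : Type*} [NormedAddCommGroup E] (hr : 1 ≤ r)
    {f : ℕ → Vec N → E} (hf : ∀ n, AEStronglyMeasurable (f n) (volume.restrict (cell x₀ v)))
    (h : Tendsto (fun n => eLpNorm (f n) (ENNReal.ofReal r) (volume.restrict (cell x₀ v)))
      atTop (𝓝 0)) :
    Tendsto (fun n => eLpNorm (f n) 1 (volume.restrict (cell x₀ v))) atTop (𝓝 0) := by
  set μ := volume.restrict (cell x₀ v)
  have hC : μ univ ^ (1 / (1 : ENNReal).toReal - 1 / (ENNReal.ofReal r).toReal) ≠ ⊤ := by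
    refine ENNReal.rpow_ne_top_of_nonneg ?_ (measure_ne_top _ _)
    rw [ENNReal.toReal_ofReal (by linarith), ENNReal.toReal_one, sub_nonneg, div_one]
    exact div_le_one_of_le₀ hr (by linarith)
  have h1 := ENNReal.Tendsto.mul_const h (Or.inr hC)
  rw [zero_mul] at h1
  exact tendsto_of_tendsto_of_tendsto_of_le_of_le tendsto_const_nhds h1 (fun _ => zero_le)
    fun n => eLpNorm_le_eLpNorm_mul_rpow_measure_univ (by simpa using hr) (hf n)

/-- Convergence on one cell controls integrals over the support of `χ`, which finitely many
translates cover up to a null set. It passes the weak gradient identity to limits. -/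
theorem tendsto_integral_mul_of_periodic (hr : 1 ≤ r) {f : ℕ → Vec N → ℝ} {g : Vec N → ℝ}
    (hf : ∀ n, MemLp (f n) (ENNReal.ofReal r) (volume.restrict (cell x₀ v)))
    (hg : MemLp g (ENNReal.ofReal r) (volume.restrict (cell x₀ v)))
    (hfp : ∀ n i x, f n (x + v i) = f n x) (hgp : ∀ i x, g (x + v i) = g x)
    (h : Tendsto (fun n => eLpNorm (f n - g) (ENNReal.ofReal r) (volume.restrict (cell x₀ v)))
      atTop (𝓝 0)) {χ : Vec N → ℝ} (hχ : Continuous χ) (hχc : HasCompactSupport χ) :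
    Tendsto (fun n => ∫ x, f n x * χ x) atTop (𝓝 (∫ x, g x * χ x)) := by
  have hint : ∀ u : Vec N → ℝ, MemLp u (ENNReal.ofReal r) (volume.restrict (cell x₀ v)) →
      (∀ i x, u (x + v i) = u x) → Integrable (fun x => u x * χ x) volume := by
    intro u hu hup
    have h1 := (locallyIntegrable_of_periodic x₀ v hup
      (integrable_cell_of_memLp hr hu)).integrable_smul_left_of_hasCompactSupport hχ hχc
    exact h1.congr (Eventually.of_forall fun x => by simp [mul_comm])
  obtain ⟨M, hM⟩ := hχ.bounded_above_of_compact_support hχc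
  obtain ⟨k, hk⟩ := exists_setLIntegral_le_of_periodic x₀ v (IsCompact.isBounded hχc)
  have hL1 := tendsto_eLpNorm_one_cell hr (fun n => ((hf n).sub hg).1) h
  have hL1' := ENNReal.Tendsto.const_mul (a := ENNReal.ofReal M * k) hL1
    (Or.inr (ENNReal.mul_ne_top ENNReal.ofReal_ne_top (ENNReal.natCast_ne_top k)))
  rw [mul_zero] at hL1'
  refine tendsto_integral_of_L1' _ (hint g hg hgp).1
    (Eventually.of_forall fun n => hint (f n) (hf n) (hfp n))
    (tendsto_of_tendsto_of_tendsto_of_le_of_le tendsto_const_nhds hL1' (fun _ => zero_le)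
      fun n => ?_)
  rw [eLpNorm_one_eq_lintegral_enorm, eLpNorm_one_eq_lintegral_enorm, mul_assoc]
  calc ∫⁻ x, ‖((fun x => f n x * χ x) - fun x => g x * χ x) x‖ₑ
      ≤ ∫⁻ x, (tsupport χ).indicator (fun x => ENNReal.ofReal M * ‖(f n - g) x‖ₑ) x := by
        refine lintegral_mono fun x => ?_
        simp only [Pi.sub_apply]
        rw [← sub_mul, enorm_mul, mul_comm]
        by_cases hx : x ∈ tsupport χ
        · rw [indicator_of_mem hx]
          gcongr
          rw [← ofReal_norm]
          exact ENNReal.ofReal_le_ofReal (hM x)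
        · rw [image_eq_zero_of_notMem_tsupport hx]
          simp
    _ = ENNReal.ofReal M * ∫⁻ x in tsupport χ, ‖(f n - g) x‖ₑ := by
        rw [lintegral_indicator (isClosed_tsupport χ).measurableSet,
          lintegral_const_mul' _ _ ENNReal.ofReal_ne_top]
    _ ≤ _ := by
        gcongr
        exact hk _ fun i x => by simp only [Pi.sub_apply, hfp, hgp]

/-- The closed subspace of `L^r` of gradients of periodic Sobolev functions. -/
noncomputable def gradientSubmodule (x₀ : Vec N) (v : Module.Basis (Fin N) ℝ (Vec N)) (hr : 1 ≤ r) :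
    Submodule ℝ (Lp (Vec N) (ENNReal.ofReal r) (volume.restrict (cell x₀ v))) where
  carrier := {u | ∃ φ G, IsPeriodicSobolev x₀ v r φ G ∧ u =ᵐ[volume.restrict (cell x₀ v)] G}
  zero_mem' := ⟨0, 0, IsPeriodicSobolev.zero x₀ v r, Lp.coeFn_zero _ _ _⟩
  add_mem' := by
    rintro a b ⟨φ, G, h, e⟩ ⟨φ', G', h', e'⟩
    exact ⟨φ + φ', G + G', h.add h' hr, (Lp.coeFn_add _ _).trans (e.add e')⟩
  smul_mem' := by
    rintro c a ⟨φ, G, h, e⟩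
    exact ⟨c • φ, c • G, h.smul c, (Lp.coeFn_smul _ _).trans (e.const_smul c)⟩

/-- By the Poincaré inequality convergent gradients have Cauchy potentials; the limits of both,
extended periodically, again form a Sobolev pair. -/
theorem isClosed_gradientSubmodule (hr : 1 ≤ r) [Fact (1 ≤ ENNReal.ofReal r)] :
    IsClosed (gradientSubmodule x₀ v hr :
      Set (Lp (Vec N) (ENNReal.ofReal r) (volume.restrict (cell x₀ v)))) := by
  set μ := volume.restrict (cell x₀ v)
  refine IsSeqClosed.isClosed fun u w hu huw => ?_
  choose φ G hS huG using hu
  obtain ⟨R, hR⟩ := IsPeriodicSobolev.exists_eLpNorm_le x₀ v hr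
  set Φ : ℕ → Lp ℝ (ENNReal.ofReal r) μ := fun n => (hS n).memLp.toLp
  have hdist : ∀ n k, dist (Φ n) (Φ k) ≤ max R 0 * dist (u n) (u k) := by
    intro n k
    have h1 := hR _ _ ((hS n).sub (hS k) hr)
    have h2 : eLpNorm (G n - G k) (ENNReal.ofReal r) μ = edist (u n) (u k) := by
      rw [Lp.edist_def]
      exact eLpNorm_congr_ae ((huG n).symm.sub (huG k).symm)
    rw [h2, ← Lp.edist_toLp_toLp _ _ (hS n).memLp (hS k).memLp, edist_dist, edist_dist,
      ← ENNReal.ofReal_mul' dist_nonneg] at h1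
    refine (ENNReal.ofReal_le_ofReal_iff (by positivity)).1 (h1.trans ?_)
    exact ENNReal.ofReal_le_ofReal (mul_le_mul_of_nonneg_right (le_max_left _ _) dist_nonneg)
  have hcau : CauchySeq Φ := by
    rw [cauchySeq_iff_tendsto_dist_atTop_0]
    have h1 := (cauchySeq_iff_tendsto_dist_atTop_0.1 huw.cauchySeq).const_mul (max R 0)
    rw [mul_zero] at h1
    exact tendsto_of_tendsto_of_tendsto_of_le_of_le tendsto_const_nhds h1 (fun _ => dist_nonneg)
      fun n => hdist n.1 n.2
  obtain ⟨Ψ, hΨ⟩ := cauchySeq_tendsto_of_complete hcau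
  set φ' : Vec N → ℝ := fun x => Ψ (foldCell x₀ v x)
  set G' : Vec N → Vec N := fun x => w (foldCell x₀ v x)
  have hφ' : φ' =ᵐ[μ] Ψ := comp_foldCell_ae_eq x₀ v Ψ
  have hG' : G' =ᵐ[μ] w := comp_foldCell_ae_eq x₀ v w
  have hφ'L : MemLp φ' (ENNReal.ofReal r) μ := (memLp_congr_ae hφ').2 (Lp.memLp Ψ)
  have hG'L : MemLp G' (ENNReal.ofReal r) μ := (memLp_congr_ae hG').2 (Lp.memLp w)
  have hφ'p : ∀ i x, φ' (x + v i) = φ' x := fun i x => by simp only [φ', foldCell_add]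
  have hG'p : ∀ i x, G' (x + v i) = G' x := fun i x => by simp only [G', foldCell_add]
  have hlimφ : Tendsto (fun n => eLpNorm (φ n - φ') (ENNReal.ofReal r) μ) atTop (𝓝 0) := by
    have h1 := (Lp.tendsto_Lp_iff_tendsto_eLpNorm' _ _).1 hΨ
    refine h1.congr fun n => eLpNorm_congr_ae ?_
    exact (hS n).memLp.coeFn_toLp.sub hφ'.symm
  have hlimG : Tendsto (fun n => eLpNorm (G n - G') (ENNReal.ofReal r) μ) atTop (𝓝 0) := by
    have h1 := (Lp.tendsto_Lp_iff_tendsto_eLpNorm' _ _).1 huw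
    exact h1.congr fun n => eLpNorm_congr_ae ((huG n).sub hG'.symm)
  refine ⟨φ', G', ⟨hφ'p, hG'p, hφ'L, hG'L, fun χ hχ hχc i => ?_, ?_⟩, hG'.symm⟩
  · have hc : Continuous fun x => fderiv ℝ χ x (EuclideanSpace.single i 1) :=
      (hχ.continuous_fderiv (by simp)).clm_apply continuous_const
    have t1 := tendsto_integral_mul_of_periodic hr (fun n => (hS n).memLp) hφ'L
      (fun n => (hS n).periodic) hφ'p hlimφ hc (hχc.fderiv_apply ℝ _)
    have hcoord : ∀ {g : Vec N → Vec N}, MemLp g (ENNReal.ofReal r) μ →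
        MemLp (fun x => g x i) (ENNReal.ofReal r) μ := fun hg =>
      (EuclideanSpace.proj i : Vec N →L[ℝ] ℝ).comp_memLp' hg
    have t2 := tendsto_integral_mul_of_periodic (f := fun n x => G n x i) (g := fun x => G' x i) hr
      (fun n => hcoord (hS n).memLp_grad) (hcoord hG'L)
      (fun n j x => by rw [(hS n).periodic_grad]) (fun j x => by rw [hG'p])
      (tendsto_of_tendsto_of_tendsto_of_le_of_le tendsto_const_nhds hlimG (fun _ => zero_le)
        fun n => eLpNorm_mono fun x => by
          simpa using PiLp.norm_apply_le (G n x - G' x) i) hχ.continuous hχc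
    refine tendsto_nhds_unique t1 (t2.neg.congr fun n => ?_)
    exact ((hS n).weakGradient χ hχ hχc i).symm
  · have t := tendsto_integral_of_L1' φ' hφ'L.1 (F := φ) (l := atTop)
      (Eventually.of_forall fun n => integrable_cell_of_memLp hr (hS n).memLp)
      (tendsto_eLpNorm_one_cell hr (fun n => ((hS n).memLp.sub hφ'L).1) hlimφ)
    simp only [μ, (hS _).mean_zero] at t
    exact tendsto_nhds_unique t tendsto_const_nhds

namespace IsPeriodicSolenoidal

variable {s : ℝ} {g g' : Vec N → Vec N}

theorem zero (x₀ : Vec N) (v : Module.Basis (Fin N) ℝ (Vec N)) (s : ℝ) :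
    IsPeriodicSolenoidal x₀ v s (0 : Vec N → Vec N) where
  memLp := MemLp.zero
  mean_zero := by simp
  orthogonal := fun φ G _ => by simp

theorem add {t : ℝ} (hst : s.HolderConjugate t) (h : IsPeriodicSolenoidal x₀ v s g)
    (h' : IsPeriodicSolenoidal x₀ v s g') : IsPeriodicSolenoidal x₀ v s (g + g') where
  memLp := h.memLp.add h'.memLp
  mean_zero := by
    simp only [Pi.add_apply]
    rw [integral_add (integrable_cell_of_memLp hst.lt.le h.memLp)
      (integrable_cell_of_memLp hst.lt.le h'.memLp), h.mean_zero, h'.mean_zero, add_zero]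
  orthogonal := fun φ G hφ => by
    have hG := hφ.memLp_grad
    rw [← hst.conjugate_eq] at hG
    simp only [Pi.add_apply, inner_add_left]
    rw [integral_add (h.memLp.integrable_inner_of_holderConjugate hst hG)
      (h'.memLp.integrable_inner_of_holderConjugate hst hG), h.orthogonal φ G hφ,
      h'.orthogonal φ G hφ, add_zero]

theorem smul (h : IsPeriodicSolenoidal x₀ v s g) (c : ℝ) :
    IsPeriodicSolenoidal x₀ v s (c • g) where
  memLp := h.memLp.const_smul c
  mean_zero := by
    simp only [Pi.smul_apply]
    rw [integral_smul, h.mean_zero, smul_zero]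
  orthogonal := fun φ G hφ => by
    simp only [Pi.smul_apply, real_inner_smul_left]
    rw [integral_const_mul, h.orthogonal φ G hφ, mul_zero]

theorem integral_inner_eq_zero {t : ℝ} (hst : s.HolderConjugate t)
    (h : IsPeriodicSolenoidal x₀ v s g) {φ : Vec N → ℝ} {G : Vec N → Vec N}
    (hφ : IsPeriodicSobolev x₀ v t φ G) : ∫ x in cell x₀ v, inner ℝ (g x) (G x) = 0 :=
  h.orthogonal φ G (by rwa [← hst.conjugate_eq])

end IsPeriodicSolenoidal

theorem setIntegral_inner_const {g : Vec N → Vec N} (hg : IntegrableOn g (cell x₀ v)) (c : Vec N) :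
    ∫ x in cell x₀ v, inner ℝ (g x) c = inner ℝ (∫ x in cell x₀ v, g x) c := by
  rw [real_inner_comm, ← integral_inner hg]
  simp only [real_inner_comm]

/-- A field of mean zero that is orthogonal to all solenoidal fields is a gradient. -/
theorem exists_isPeriodicSobolev_of_orthogonal {s : ℝ} (hrs : r.HolderConjugate s)
    {Γ : Vec N → Vec N} (hΓ : MemLp Γ (ENNReal.ofReal r) (volume.restrict (cell x₀ v)))
    (hmean : ∫ x in cell x₀ v, Γ x = 0)
    (horth : ∀ g, IsPeriodicSolenoidal x₀ v s g → ∫ x in cell x₀ v, inner ℝ (g x) (Γ x) = 0) :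
    ∃ φ G, IsPeriodicSobolev x₀ v r φ G ∧ Γ =ᵐ[volume.restrict (cell x₀ v)] G := by
  set μ := volume.restrict (cell x₀ v)
  have hr : 1 ≤ r := hrs.lt.le
  have : Fact (1 ≤ ENNReal.ofReal r) := ⟨by simpa using hr⟩
  by_cases hmem : hΓ.toLp Γ ∈ gradientSubmodule x₀ v hr
  · obtain ⟨φ, G, h, e⟩ := hmem
    exact ⟨φ, G, h, hΓ.coeFn_toLp.symm.trans e⟩
  exfalso
  -- A functional vanishing on gradients but not at `Γ` has a density which, after subtraction of
  -- its mean, is solenoidal; so it must annihilate `Γ` after all.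
  obtain ⟨ℓ, hℓ0, hℓ⟩ := Submodule.exists_clm_eq_zero_of_notMem_of_isClosed
    (isClosed_gradientSubmodule hr) hmem
  obtain ⟨ξ, hξ, hrep⟩ := Lp.exists_forall_eq_integral_inner hrs ℓ
  have hξi := integrable_cell_of_memLp hrs.symm.lt.le hξ
  set c : Vec N := ⨍ x in cell x₀ v, ξ x
  -- Subtracting the mean from the density is invisible to fields of mean zero.
  have hval : ∀ {H : Vec N → Vec N} (hH : MemLp H (ENNReal.ofReal r) μ),
      ∫ x in cell x₀ v, H x = 0 → ∫ x in cell x₀ v, inner ℝ (ξ x - c) (H x) = ℓ hH.toLp := by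
    intro H hH hH0
    have i1 := hξ.integrable_inner_of_holderConjugate hrs.symm hH
    have i2 : Integrable (fun x => (inner ℝ c (H x) : ℝ)) μ :=
      (integrable_cell_of_memLp hr hH).const_inner c
    simp only [inner_sub_left]
    rw [integral_sub i1 i2, integral_inner (integrable_cell_of_memLp hr hH), hH0, inner_zero_right,
      sub_zero, hrep]
    refine integral_congr_ae ?_
    filter_upwards [hH.coeFn_toLp] with x hx
    rw [hx, real_inner_comm]
  have hsol : IsPeriodicSolenoidal x₀ v s (fun x => ξ x - c) :=
    { memLp := hξ.sub (memLp_const c)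
      mean_zero := by
        have := integral_sub_average μ ξ
        exact this
      orthogonal := fun φ G hφ => by
        rw [← hrs.symm.conjugate_eq] at hφ
        rw [hval hφ.memLp_grad (hφ.integral_grad_eq_zero hr)]
        exact hℓ0 _ ⟨φ, G, hφ, hφ.memLp_grad.coeFn_toLp⟩ }
  apply hℓ
  rw [← hval hΓ hmean]
  exact horth _ hsol

end PeriodicCell

/-! ### Duality for the cell problem. -/

namespace PeriodicCell

open Filter Topology

variable {N : ℕ} {x₀ : Vec N} {v : Module.Basis (Fin N) ℝ (Vec N)} {r s p q p' q' : ℝ}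
  {L : Vec N → Vec N → Vec N → ℝ}

/-- The fields `a + ∇φ` with `a` constant and `φ` periodic. -/
def gradientFields (x₀ : Vec N) (v : Module.Basis (Fin N) ℝ (Vec N)) (hr : 1 ≤ r) :
    Submodule ℝ (Vec N → Vec N) where
  carrier := {u | ∃ a φ G, IsPeriodicSobolev x₀ v r φ G ∧ u = fun x => a + G x}
  zero_mem' := ⟨0, 0, 0, IsPeriodicSobolev.zero x₀ v r, by ext; simp⟩
  add_mem' := by
    rintro _ _ ⟨a, φ, G, h, rfl⟩ ⟨a', φ', G', h', rfl⟩
    refine ⟨a + a', φ + φ', G + G', h.add h' hr, ?_⟩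
    funext x
    simp only [Pi.add_apply]
    abel
  smul_mem' := by
    rintro c _ ⟨a, φ, G, h, rfl⟩
    exact ⟨c • a, c • φ, c • G, h.smul c, by ext; simp⟩

/-- The fields `b + g` with `b` constant and `g` periodic and solenoidal. -/
def solenoidalFields (x₀ : Vec N) (v : Module.Basis (Fin N) ℝ (Vec N))
    (hst : s.HolderConjugate r) : Submodule ℝ (Vec N → Vec N) where
  carrier := {u | ∃ b g, IsPeriodicSolenoidal x₀ v s g ∧ u = fun x => b + g x}
  zero_mem' := ⟨0, 0, IsPeriodicSolenoidal.zero x₀ v s, by ext; simp⟩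
  add_mem' := by
    rintro _ _ ⟨b, g, h, rfl⟩ ⟨b', g', h', rfl⟩
    refine ⟨b + b', g + g', h.add hst h', ?_⟩
    funext x
    simp only [Pi.add_apply]
    abel
  smul_mem' := by
    rintro c _ ⟨b, g, h, rfl⟩
    exact ⟨c • b, c • g, h.smul c, by ext; simp⟩

theorem IsPeriodicSobolev.memLp_const_add {φ : Vec N → ℝ} {G : Vec N → Vec N}
    (h : IsPeriodicSobolev x₀ v r φ G) (a : Vec N) :
    MemLp (fun x => a + G x) (ENNReal.ofReal r) (volume.restrict (cell x₀ v)) :=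
  (memLp_const a).add h.memLp_grad

theorem IsPeriodicSolenoidal.memLp_const_add {g : Vec N → Vec N}
    (h : IsPeriodicSolenoidal x₀ v s g) (b : Vec N) :
    MemLp (fun x => b + g x) (ENNReal.ofReal s) (volume.restrict (cell x₀ v)) :=
  (memLp_const b).add h.memLp

theorem integral_inner_const_add (hrs : r.HolderConjugate s) {g G : Vec N → Vec N}
    (hg : MemLp g (ENNReal.ofReal r) (volume.restrict (cell x₀ v)))
    (hG : MemLp G (ENNReal.ofReal s) (volume.restrict (cell x₀ v)))
    (hg0 : ∫ x in cell x₀ v, g x = 0) (hG0 : ∫ x in cell x₀ v, G x = 0) (a b : Vec N) :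
    ∫ x in cell x₀ v, inner ℝ (a + g x) (b + G x) =
      volume.real (cell x₀ v) * inner ℝ a b + ∫ x in cell x₀ v, inner ℝ (g x) (G x) := by
  have hgi := integrable_cell_of_memLp hrs.lt.le hg
  have hGi := integrable_cell_of_memLp hrs.symm.lt.le hG
  have i1 : IntegrableOn (fun x => (inner ℝ a (G x) : ℝ)) (cell x₀ v) := hGi.const_inner a
  have i2 : IntegrableOn (fun x => (inner ℝ (g x) b : ℝ)) (cell x₀ v) := hgi.inner_const b
  have i3 : IntegrableOn (fun x => (inner ℝ (g x) (G x) : ℝ)) (cell x₀ v) :=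
    hg.integrable_inner_of_holderConjugate hrs hG
  have i0 : IntegrableOn (fun _ => (inner ℝ a b : ℝ)) (cell x₀ v) := integrable_const _
  have e : ∀ x, (inner ℝ (a + g x) (b + G x) : ℝ) =
      (inner ℝ a b + inner ℝ a (G x)) + (inner ℝ (g x) b + inner ℝ (g x) (G x)) := fun x => by
    rw [inner_add_left, inner_add_right, inner_add_right]
  simp only [e]
  have i01 : IntegrableOn (fun x => (inner ℝ a b + inner ℝ a (G x) : ℝ)) (cell x₀ v) := i0.add i1
  have i23 : IntegrableOn (fun x => (inner ℝ (g x) b + inner ℝ (g x) (G x) : ℝ)) (cell x₀ v) :=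
    i2.add i3
  rw [integral_add i01 i23, integral_add i0 i1, integral_add i2 i3,
    integral_inner hGi, hG0, setIntegral_inner_const hgi, hg0, inner_zero_left, inner_zero_right,
    setIntegral_const, smul_eq_mul]
  ring

/-- Only the constants survive: the mixed terms vanish by the zero means, the last one by
orthogonality. -/
theorem IsPeriodicSolenoidal.integral_inner_const_add (hsr : s.HolderConjugate r)
    {g : Vec N → Vec N} (hg : IsPeriodicSolenoidal x₀ v s g) {φ : Vec N → ℝ} {G : Vec N → Vec N}
    (hG : IsPeriodicSobolev x₀ v r φ G) (a b : Vec N) :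
    ∫ x in cell x₀ v, inner ℝ (b + g x) (a + G x) = volume.real (cell x₀ v) * inner ℝ b a := by
  rw [PeriodicCell.integral_inner_const_add hsr hg.memLp hG.memLp_grad hg.mean_zero
    (hG.integral_grad_eq_zero hsr.symm.lt.le), hg.integral_inner_eq_zero hsr hG, add_zero]

theorem eq_zero_of_forall_integral_inner_const {ζ : Vec N → Vec N} (hζ : IntegrableOn ζ (cell x₀ v))
    (h : ∀ a : Vec N, ∫ x in cell x₀ v, inner ℝ a (ζ x) = 0) : ∫ x in cell x₀ v, ζ x = 0 := by
  have h1 := h (∫ x in cell x₀ v, ζ x)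
  rw [integral_inner hζ] at h1
  exact inner_self_eq_zero.1 h1

theorem integral_inner_sub_const (hrs : r.HolderConjugate s) {u ζ : Vec N → Vec N}
    (hu : MemLp u (ENNReal.ofReal r) (volume.restrict (cell x₀ v)))
    (hζ : MemLp ζ (ENNReal.ofReal s) (volume.restrict (cell x₀ v))) (c : Vec N) :
    ∫ x in cell x₀ v, inner ℝ (u x) (ζ x - c) =
      (∫ x in cell x₀ v, inner ℝ (u x) (ζ x)) - ∫ x in cell x₀ v, inner ℝ (u x) c := by
  simp only [inner_sub_right]
  exact integral_sub (hu.integrable_inner_of_holderConjugate hrs hζ)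
    ((integrable_cell_of_memLp hrs.lt.le hu).inner_const c)

/-- Identifies one component of the fields from `exists_dual`: constant test fields give mean zero,
gradients give orthogonality. -/
theorem isPeriodicSolenoidal_sub_const (hsr : s.HolderConjugate r) {ζ : Vec N → Vec N} {c : Vec N}
    (hζ : MemLp ζ (ENNReal.ofReal s) (volume.restrict (cell x₀ v)))
    (h : ∀ u ∈ gradientFields x₀ v hsr.symm.lt.le, ∫ x in cell x₀ v, inner ℝ (u x) (ζ x) =
      ∫ x in cell x₀ v, inner ℝ (u x) c) :
    IsPeriodicSolenoidal x₀ v s (fun x => ζ x - c) := by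
  have hζc : MemLp (fun x => ζ x - c) (ENNReal.ofReal s) (volume.restrict (cell x₀ v)) :=
    hζ.sub (memLp_const c)
  have key : ∀ a φ G, IsPeriodicSobolev x₀ v r φ G →
      ∫ x in cell x₀ v, inner ℝ (a + G x) (ζ x - c) = 0 := by
    intro a φ G hG
    rw [integral_inner_sub_const hsr.symm (hG.memLp_const_add a) hζ, sub_eq_zero]
    exact h _ ⟨a, φ, G, hG, rfl⟩
  refine ⟨hζc, ?_, fun φ G hG => ?_⟩
  · refine eq_zero_of_forall_integral_inner_const (integrable_cell_of_memLp hsr.lt.le hζc)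
      fun a => ?_
    simpa using key a 0 0 (IsPeriodicSobolev.zero x₀ v r)
  · rw [← hsr.conjugate_eq] at hG
    have := key 0 φ G hG
    simp only [zero_add] at this
    simpa only [real_inner_comm] using this

/-- The counterpart for the other component; a mean-zero field orthogonal to the solenoidal ones is
a gradient because gradients form a closed space. -/
theorem exists_isPeriodicSobolev_ae_eq_const_add (hsr : s.HolderConjugate r) {ζ : Vec N → Vec N}
    {c : Vec N} (hζ : MemLp ζ (ENNReal.ofReal r) (volume.restrict (cell x₀ v)))
    (h : ∀ u ∈ solenoidalFields x₀ v hsr, ∫ x in cell x₀ v, inner ℝ (u x) (ζ x) =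
      ∫ x in cell x₀ v, inner ℝ (u x) c) :
    ∃ φ G, IsPeriodicSobolev x₀ v r φ G ∧
      ζ =ᵐ[volume.restrict (cell x₀ v)] fun x => c + G x := by
  have hζc : MemLp (fun x => ζ x - c) (ENNReal.ofReal r) (volume.restrict (cell x₀ v)) :=
    hζ.sub (memLp_const c)
  have key : ∀ b g, IsPeriodicSolenoidal x₀ v s g →
      ∫ x in cell x₀ v, inner ℝ (b + g x) (ζ x - c) = 0 := by
    intro b g hg
    rw [integral_inner_sub_const hsr (hg.memLp_const_add b) hζ, sub_eq_zero]
    exact h _ ⟨b, g, hg, rfl⟩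
  obtain ⟨φ, G, hG, e⟩ := exists_isPeriodicSobolev_of_orthogonal hsr.symm hζc
    (eq_zero_of_forall_integral_inner_const (integrable_cell_of_memLp hsr.symm.lt.le hζc)
      fun b => by simpa using key b 0 (IsPeriodicSolenoidal.zero x₀ v s))
    (fun g hg => by simpa using key 0 g hg)
  refine ⟨φ, G, hG, e.mono fun x hx => ?_⟩
  simp only at hx ⊢
  rw [← hx, add_sub_cancel]

theorem volume_real_cell_pos (x₀ : Vec N) (v : Module.Basis (Fin N) ℝ (Vec N)) :
    0 < volume.real (cell x₀ v) :=
  ENNReal.toReal_pos (volume_cell_pos x₀ v).ne' (isBounded_cell x₀ v).measure_lt_top.ne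

theorem setAverage_eq_inv_mul (f : Vec N → ℝ) :
    ⨍ x in cell x₀ v, f x = (volume.real (cell x₀ v))⁻¹ * ∫ x in cell x₀ v, f x := by
  rw [setAverage_eq, smul_eq_mul]

theorem cellValues_nonempty (p q : ℝ) (L : Vec N → Vec N → Vec N → ℝ) (a b : Vec N) :
    (cellValues x₀ v p q L a b).Nonempty :=
  ⟨_, 0, 0, 0, IsPeriodicSobolev.zero x₀ v p, IsPeriodicSolenoidal.zero x₀ v q, rfl⟩

section Lagrangian

variable (hL : IsGrowthIntegrand (volume.restrict (cell x₀ v)) p q L)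
  (hp : p.HolderConjugate p') (hq : q.HolderConjugate q')

include hL hp hq

theorem integrableOn_lagrangian {a b : Vec N} {φ : Vec N → ℝ} {G g : Vec N → Vec N}
    (hG : IsPeriodicSobolev x₀ v p φ G) (hg : IsPeriodicSolenoidal x₀ v q g) :
    IntegrableOn (fun x => L x (a + G x) (b + g x)) (cell x₀ v) :=
  hL.integrable_comp hp.pos hq.pos (hG.memLp_const_add a) (hg.memLp_const_add b)

theorem integrableOn_conj {a' b' : Vec N} {φ : Vec N → ℝ} {G g : Vec N → Vec N}
    (hG : IsPeriodicSobolev x₀ v q' φ G) (hg : IsPeriodicSolenoidal x₀ v p' g) :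
    IntegrableOn (fun x => conj (L x) (a' + g x) (b' + G x)) (cell x₀ v) :=
  (hL.conj hp hq).integrable_comp hp.symm.pos hq.symm.pos (hg.memLp_const_add a')
    (hG.memLp_const_add b')

/-- Weak duality: the Fenchel-Young inequality averaged over the cell, where the pairings see only
the constants. -/
theorem inner_add_inner_le_average {a b a' b' : Vec N} {φ ψ : Vec N → ℝ} {G H g h : Vec N → Vec N}
    (hG : IsPeriodicSobolev x₀ v p φ G) (hg : IsPeriodicSolenoidal x₀ v q g)
    (hH : IsPeriodicSobolev x₀ v q' ψ H) (hh : IsPeriodicSolenoidal x₀ v p' h) :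
    inner ℝ a a' + inner ℝ b b' ≤ (⨍ x in cell x₀ v, L x (a + G x) (b + g x)) +
      ⨍ x in cell x₀ v, conj (L x) (a' + h x) (b' + H x) := by
  have hm := volume_real_cell_pos x₀ v
  have i1 := integrableOn_lagrangian hL hp hq hG hg (a := a) (b := b)
  have i2 := integrableOn_conj hL hp hq hH hh (a' := a') (b' := b')
  have e1 := hh.integral_inner_const_add hp.symm hG a a'
  have e2 := hg.integral_inner_const_add hq hH b' b
  have i3 := (hh.memLp_const_add a').integrable_inner_of_holderConjugate hp.symm
    (hG.memLp_const_add a)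
  have i4 := (hg.memLp_const_add b).integrable_inner_of_holderConjugate hq (hH.memLp_const_add b')
  have hle := integral_mono_ae (i3.add i4) (i1.add i2) (by
    filter_upwards [hL.ae_bddAbove_conjValues hp hq] with x hx
    have := le_conj (hx (a' + h x) (b' + H x)) (a + G x) (b + g x)
    simp only [Pi.add_apply]
    rw [real_inner_comm]
    linarith)
  simp only [Pi.add_apply] at hle
  rw [integral_add i3 i4, integral_add i1 i2, e1, e2, ← mul_add, real_inner_comm] at hle
  rw [setAverage_eq_inv_mul, setAverage_eq_inv_mul, ← mul_add, le_inv_mul_iff₀ hm]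
  exact hle

theorem inner_add_inner_sub_le_homLagrangian {a b a' b' : Vec N} {ψ : Vec N → ℝ}
    {H h : Vec N → Vec N}
    (hH : IsPeriodicSobolev x₀ v q' ψ H) (hh : IsPeriodicSolenoidal x₀ v p' h) :
    inner ℝ a a' + inner ℝ b b' - (⨍ x in cell x₀ v, conj (L x) (a' + h x) (b' + H x)) ≤
      homLagrangian x₀ v p q L a b := by
  refine le_csInf (cellValues_nonempty p q L a b) ?_
  rintro _ ⟨φ, G, g, hG, hg, rfl⟩
  have := inner_add_inner_le_average hL hp hq hG hg hH hh (a := a) (b := b) (a' := a') (b' := b')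
  linarith

theorem bddBelow_cellValues (a b : Vec N) : BddBelow (cellValues x₀ v p q L a b) := by
  refine ⟨- ⨍ x in cell x₀ v, conj (L x) ((0 : Vec N) + (0 : Vec N → Vec N) x)
    ((0 : Vec N) + (0 : Vec N → Vec N) x), ?_⟩
  rintro _ ⟨φ, G, g, hG, hg, rfl⟩
  have := inner_add_inner_le_average hL hp hq hG hg (IsPeriodicSobolev.zero x₀ v q')
    (IsPeriodicSolenoidal.zero x₀ v p') (a := a) (b := b) (a' := 0) (b' := 0)
  rw [inner_zero_right, inner_zero_right] at this
  linarith

theorem homLagrangian_le {a b : Vec N} {φ : Vec N → ℝ} {G g : Vec N → Vec N}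
    (hG : IsPeriodicSobolev x₀ v p φ G) (hg : IsPeriodicSolenoidal x₀ v q g) :
    homLagrangian x₀ v p q L a b ≤ ⨍ x in cell x₀ v, L x (a + G x) (b + g x) :=
  csInf_le (bddBelow_cellValues hL hp hq a b) ⟨φ, G, g, hG, hg, rfl⟩

/-- The minimum in the cell problem is attained. -/
theorem exists_homLagrangian_eq (a b : Vec N) :
    ∃ φ G g, IsPeriodicSobolev x₀ v p φ G ∧ IsPeriodicSolenoidal x₀ v q g ∧
      homLagrangian x₀ v p q L a b = ⨍ x in cell x₀ v, L x (a + G x) (b + g x) := by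
  have hm := volume_real_cell_pos x₀ v
  set W := (solenoidalFields x₀ v hp.symm).prod (gradientFields x₀ v hq.symm.lt.le)
  -- The duality result is applied to `L^*`, with weak duality as its hypothesis; its fields live in
  -- the primal spaces, and `L^** = L` turns them into a minimizer.
  obtain ⟨ξ, η, hξ, hη, hW, hle⟩ := (hL.conj hp hq).exists_dual hp.symm hq.symm W
    (by
      rintro ⟨_, _⟩ ⟨⟨a', h, hh, rfl⟩, ⟨b', ψ, H, hH, rfl⟩⟩
      exact ⟨hh.memLp_const_add a', hH.memLp_const_add b'⟩)
    (memLp_const a) (memLp_const b) (S := volume.real (cell x₀ v) * homLagrangian x₀ v p q L a b)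
    (by
      rintro ⟨_, _⟩ ⟨⟨a', h, hh, rfl⟩, ⟨b', ψ, H, hH, rfl⟩⟩
      have h1 := inner_add_inner_sub_le_homLagrangian hL hp hq hH hh (a := a) (b := b)
        (a' := a') (b' := b')
      have e1 := hh.integral_inner_const_add hp.symm (IsPeriodicSobolev.zero x₀ v p) a a'
      have e2 := (IsPeriodicSolenoidal.zero x₀ v q).integral_inner_const_add hq hH b' b
      simp only [Pi.zero_apply, add_zero] at e1 e2
      simp only [real_inner_comm b, e1]
      rw [e2, real_inner_comm, ← mul_add, ← mul_inv_cancel_left₀ hm.ne'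
        (∫ x in cell x₀ v, conj (L x) (a' + h x) (b' + H x)), ← mul_sub, ← setAverage_eq_inv_mul]
      exact mul_le_mul_of_nonneg_left h1 hm.le)
  obtain ⟨φ, G, hG, hGe⟩ := exists_isPeriodicSobolev_ae_eq_const_add hp.symm hξ (c := a) (by
    intro u hu
    simpa using hW (u, 0) ⟨hu, Submodule.zero_mem _⟩)
  have hg := isPeriodicSolenoidal_sub_const hq hη (c := b) (by
    intro u hu
    simpa using hW (0, u) ⟨Submodule.zero_mem _, hu⟩)
  refine ⟨φ, G, _, hG, hg, le_antisymm (homLagrangian_le hL hp hq hG hg) ?_⟩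
  rw [setAverage_eq_inv_mul, inv_mul_le_iff₀ hm]
  refine le_trans (le_of_eq ?_) hle
  refine integral_congr_ae ?_
  filter_upwards [hGe, hL.ae_conj_conj hp hq] with x hx hxx
  rw [hxx, hx, add_sub_cancel]

/-- Convex combinations of minimizers are competitors for the combined constants. -/
theorem convexOn_homLagrangian :
    ConvexOn ℝ univ fun z : Vec N × Vec N => homLagrangian x₀ v p q L z.1 z.2 := by
  have hm := volume_real_cell_pos x₀ v
  refine ⟨convex_univ, fun z _ w _ s t hs ht hst => ?_⟩
  obtain ⟨φ, G, g, hG, hg, e⟩ := exists_homLagrangian_eq hL hp hq z.1 z.2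
  obtain ⟨φ', G', g', hG', hg', e'⟩ := exists_homLagrangian_eq hL hp hq w.1 w.2
  have hG'' := (hG.smul s).add (hG'.smul t) hp.lt.le
  have hg'' := (hg.smul s).add hq (hg'.smul t)
  refine (homLagrangian_le hL hp hq hG'' hg'').trans ?_
  simp only [e, e', smul_eq_mul, setAverage_eq_inv_mul]
  rw [mul_left_comm s, mul_left_comm t, ← mul_add]
  refine mul_le_mul_of_nonneg_left ?_ (inv_pos.2 hm).le
  have i1 := integrableOn_lagrangian hL hp hq hG hg (a := z.1) (b := z.2)
  have i2 := integrableOn_lagrangian hL hp hq hG' hg' (a := w.1) (b := w.2)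
  rw [← integral_const_mul, ← integral_const_mul, ← integral_add (i1.const_mul s) (i2.const_mul t)]
  refine integral_mono_ae (integrableOn_lagrangian hL hp hq hG'' hg'')
    ((i1.const_mul s).add (i2.const_mul t)) ?_
  filter_upwards [hL.convex] with x hx
  have h := hx.2 (mem_univ (z.1 + G x, z.2 + g x)) (mem_univ (w.1 + G' x, w.2 + g' x)) hs ht hst
  simp only [Prod.fst_add, Prod.snd_add, Prod.smul_fst, Prod.smul_snd, Pi.add_apply,
    Pi.smul_apply, smul_eq_mul] at h ⊢
  convert h using 2 <;> simp only [smul_add] <;> abel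

theorem bddAbove_conjValues_homLagrangian (a' b' : Vec N) :
    BddAbove (conjValues (homLagrangian x₀ v p q L) a' b') := by
  refine bddAbove_conjValues (t := ⨍ x in cell x₀ v, conj (L x) (a' + (0 : Vec N → Vec N) x)
    (b' + (0 : Vec N → Vec N) x)) fun a b => ?_
  have := inner_add_inner_sub_le_homLagrangian hL hp hq (IsPeriodicSobolev.zero x₀ v q')
    (IsPeriodicSolenoidal.zero x₀ v p') (a := a) (b := b) (a' := a') (b' := b')
  linarith

/-- The conjugate of the homogenized Lagrangian is the value of the dual cell problem. -/
theorem isLeast_conj_homLagrangian (a' b' : Vec N) :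
    IsLeast (dualCellValues x₀ v p' q' L a' b') (conj (homLagrangian x₀ v p q L) a' b') := by
  have hm := volume_real_cell_pos x₀ v
  have hlb : conj (homLagrangian x₀ v p q L) a' b' ∈
      lowerBounds (dualCellValues x₀ v p' q' L a' b') := by
    rintro _ ⟨ψ, H, h, hH, hh, rfl⟩
    refine conj_le fun a b => ?_
    have := inner_add_inner_sub_le_homLagrangian hL hp hq hH hh (a := a) (b := b)
      (a' := a') (b' := b')
    linarith
  refine ⟨?_, hlb⟩
  set W := (gradientFields x₀ v hp.lt.le).prod (solenoidalFields x₀ v hq)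
  -- The constants are part of `W`, so the hypothesis combines both optimizations: over fluctuations
  -- for `L_hom`, then over `(a, b)` for its conjugate.
  obtain ⟨ξ, η, hξ, hη, hW, hle⟩ := hL.exists_dual hp hq W
    (by
      rintro ⟨_, _⟩ ⟨⟨a, φ, G, hG, rfl⟩, ⟨b, g, hg, rfl⟩⟩
      exact ⟨hG.memLp_const_add a, hg.memLp_const_add b⟩)
    (memLp_const a') (memLp_const b')
    (S := volume.real (cell x₀ v) * conj (homLagrangian x₀ v p q L) a' b')
    (by
      rintro ⟨_, _⟩ ⟨⟨a, φ, G, hG, rfl⟩, ⟨b, g, hg, rfl⟩⟩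
      have h1 := homLagrangian_le hL hp hq hG hg (a := a) (b := b)
      have h2 := le_conj (bddAbove_conjValues_homLagrangian hL hp hq a' b') a b
      have e1 := (IsPeriodicSolenoidal.zero x₀ v p').integral_inner_const_add hp.symm hG a a'
      have e2 := hg.integral_inner_const_add hq (IsPeriodicSobolev.zero x₀ v q') b' b
      simp only [Pi.zero_apply, add_zero] at e1 e2
      simp only [real_inner_comm a', e2]
      rw [e1, real_inner_comm, ← mul_add, ← mul_inv_cancel_left₀ hm.ne'
        (∫ x in cell x₀ v, L x (a + G x) (b + g x)), ← mul_sub, ← setAverage_eq_inv_mul]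
      exact mul_le_mul_of_nonneg_left (by linarith) hm.le)
  obtain ⟨ψ, H, hH, hHe⟩ := exists_isPeriodicSobolev_ae_eq_const_add hq hη (c := b') (by
    intro u hu
    simpa using hW (0, u) ⟨Submodule.zero_mem _, hu⟩)
  have hh := isPeriodicSolenoidal_sub_const hp.symm hξ (c := a') (by
    intro u hu
    simpa using hW (u, 0) ⟨hu, Submodule.zero_mem _⟩)
  refine ⟨ψ, H, _, hH, hh, le_antisymm (hlb ⟨ψ, H, _, hH, hh, rfl⟩) ?_⟩
  rw [setAverage_eq_inv_mul, inv_mul_le_iff₀ hm]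
  refine le_trans (le_of_eq ?_) hle
  refine integral_congr_ae ?_
  filter_upwards [hHe] with x hx
  rw [hx, add_sub_cancel]

end Lagrangian

theorem convexOn_norm_rpow (hr : 1 ≤ r) : ConvexOn ℝ univ fun x : Vec N => ‖x‖ ^ r := by
  refine ⟨convex_univ, fun x _ y _ s t hs ht hst => ?_⟩
  have h1 : ‖s • x + t • y‖ ≤ s • ‖x‖ + t • ‖y‖ := by
    refine (norm_add_le _ _).trans (le_of_eq ?_)
    rw [norm_smul, norm_smul, Real.norm_of_nonneg hs, Real.norm_of_nonneg ht, smul_eq_mul,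
      smul_eq_mul]
  exact (Real.rpow_le_rpow (norm_nonneg _) h1 (by linarith)).trans
    ((convexOn_rpow hr).2 (norm_nonneg x) (norm_nonneg y) hs ht hst)

/-- Jensen's inequality, `a` being the mean of `a + g`. -/
theorem norm_rpow_le_average_const_add (hr : 1 ≤ r) {g : Vec N → Vec N}
    (hg : MemLp g (ENNReal.ofReal r) (volume.restrict (cell x₀ v)))
    (hg0 : ∫ x in cell x₀ v, g x = 0) (a : Vec N) :
    ‖a‖ ^ r ≤ ⨍ x in cell x₀ v, ‖a + g x‖ ^ r := by
  have hr0 : 0 < r := by linarith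
  have hag : MemLp (fun x => a + g x) (ENNReal.ofReal r) (volume.restrict (cell x₀ v)) :=
    (memLp_const a).add hg
  have hmean : ⨍ x in cell x₀ v, (a + g x) = a := by
    rw [setAverage_eq, integral_add (integrable_const a) (integrable_cell_of_memLp hr hg), hg0,
      add_zero, setIntegral_const, smul_smul, inv_mul_cancel₀ (volume_real_cell_pos x₀ v).ne',
      one_smul]
  have h := (convexOn_norm_rpow (N := N) hr).map_average_le
    (μ := volume.restrict (cell x₀ v)) (f := fun x => a + g x)
    (continuous_norm.rpow_const fun _ => Or.inr hr0.le).continuousOn isClosed_univ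
    (Eventually.of_forall fun _ => mem_univ _) (integrable_cell_of_memLp hr hag)
    (hag.integrable_rpow_ofReal hr0)
  rwa [hmean] at h

theorem isGrowthIntegrand_of_isLagrangian {Ω : Set (Vec N)} (hQ : cell x₀ v ⊆ Ω)
    (hL : IsLagrangian Ω L) {C₀ C₁ : ℝ} (hC₀ : 0 < C₀) (hC₁ : 0 < C₁) {n₀ n₁ : Vec N → ℝ}
    (hn₀ : IntegrableOn n₀ Ω) (hn₁ : IntegrableOn n₁ Ω)
    (hbd : ∀ᵐ x ∂(volume.restrict Ω), ∀ a b : Vec N,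
      C₀ * (‖a‖ ^ p + ‖b‖ ^ q - n₀ x) ≤ L x a b ∧
        L x a b ≤ C₁ * (‖a‖ ^ p + ‖b‖ ^ q + n₁ x)) :
    IsGrowthIntegrand (volume.restrict (cell x₀ v)) p q L where
  aestronglyMeasurable a b := by
    -- Sections of the jointly measurable map are Lebesgue measurable, hence almost everywhere equal
    -- to a Borel function.
    have h1 : NullMeasurable (Ω.indicator fun x => L x a b) volume :=
      hL.measurable.comp (measurable_id.prodMk (measurable_const (a := (a, b))))
    have h2 : AEMeasurable (Ω.indicator fun x => L x a b) volume := h1.aemeasurable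
    refine (h2.aestronglyMeasurable.restrict (s := cell x₀ v)).congr ?_
    filter_upwards [ae_restrict_mem (measurableSet_cell x₀ v)] with x hx
    rw [indicator_of_mem (hQ hx)]
  convex := ae_restrict_of_ae_restrict_of_subset hQ hL.convex
  growth := by
    refine ⟨C₀, C₁, fun x => C₀ * n₀ x, fun x => C₁ * n₁ x, hC₀, hC₁,
      (hn₀.mono_set hQ).const_mul C₀, (hn₁.mono_set hQ).const_mul C₁, ?_⟩
    filter_upwards [ae_restrict_of_ae_restrict_of_subset hQ hbd] with x hx a b
    obtain ⟨h1, h2⟩ := hx a b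
    constructor <;> linarith

end PeriodicCell

/-! ### The main theorem. -/

theorem proposition3p4 {N : ℕ} (x₀ : PeriodicCell.Vec N)
    (v : Module.Basis (Fin N) ℝ (PeriodicCell.Vec N))
    (Ω : Set (PeriodicCell.Vec N)) (hΩ : IsOpen Ω) (hQ : PeriodicCell.cell x₀ v ⊆ Ω)
    (p q p' q' : ℝ) (hp : 1 < p) (hq : 1 < q)
    (hpp' : 1 / p + 1 / p' = 1) (hqq' : 1 / q + 1 / q' = 1)
    (L : PeriodicCell.Vec N → PeriodicCell.Vec N → PeriodicCell.Vec N → ℝ)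
    (hL : PeriodicCell.IsLagrangian Ω L)
    (C₀ C₁ : ℝ) (hC₀ : 0 < C₀) (hC₁ : 0 < C₁) (n₀ n₁ : PeriodicCell.Vec N → ℝ)
    (hn₀ : IntegrableOn n₀ Ω) (hn₁ : IntegrableOn n₁ Ω)
    (hbd : ∀ᵐ x ∂(volume.restrict Ω), ∀ a b : PeriodicCell.Vec N,
      C₀ * (‖a‖ ^ p + ‖b‖ ^ q - n₀ x) ≤ L x a b ∧
        L x a b ≤ C₁ * (‖a‖ ^ p + ‖b‖ ^ q + n₁ x)) :
    -- the integrals, suprema and infima involved are finite, and `L_hom` is a minimum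
    (∀ (a b : PeriodicCell.Vec N) (φ : PeriodicCell.Vec N → ℝ)
        (G g : PeriodicCell.Vec N → PeriodicCell.Vec N),
        PeriodicCell.IsPeriodicSobolev x₀ v p φ G → PeriodicCell.IsPeriodicSolenoidal x₀ v q g →
        IntegrableOn (fun x => L x (a + G x) (b + g x)) (PeriodicCell.cell x₀ v)) ∧
    (∀ a b : PeriodicCell.Vec N, IsLeast (PeriodicCell.cellValues x₀ v p q L a b)
        (PeriodicCell.homLagrangian x₀ v p q L a b)) ∧
    (∀ᵐ x ∂(volume.restrict (PeriodicCell.cell x₀ v)), ∀ a' b' : PeriodicCell.Vec N,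
        BddAbove (PeriodicCell.conjValues (L x) a' b')) ∧
    (∀ (a' b' : PeriodicCell.Vec N) (φ : PeriodicCell.Vec N → ℝ)
        (G g : PeriodicCell.Vec N → PeriodicCell.Vec N),
        PeriodicCell.IsPeriodicSobolev x₀ v q' φ G → PeriodicCell.IsPeriodicSolenoidal x₀ v p' g →
        IntegrableOn (fun x => PeriodicCell.conj (L x) (a' + g x) (b' + G x))
          (PeriodicCell.cell x₀ v)) ∧
    -- `L_hom` is convex and lower semicontinuous
    ConvexOn ℝ univ (fun z : PeriodicCell.Vec N × PeriodicCell.Vec N =>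
        PeriodicCell.homLagrangian x₀ v p q L z.1 z.2) ∧
    LowerSemicontinuous (fun z : PeriodicCell.Vec N × PeriodicCell.Vec N =>
        PeriodicCell.homLagrangian x₀ v p q L z.1 z.2) ∧
    -- the conjugate of `L_hom` is the infimum of the dual cell problem
    (∀ a' b' : PeriodicCell.Vec N,
        BddAbove (PeriodicCell.conjValues (PeriodicCell.homLagrangian x₀ v p q L) a' b') ∧
        IsGLB (PeriodicCell.dualCellValues x₀ v p' q' L a' b')
          (PeriodicCell.conj (PeriodicCell.homLagrangian x₀ v p q L) a' b')) ∧
    -- growth of `L_hom`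
    (∀ a b : PeriodicCell.Vec N,
        C₀ * (‖a‖ ^ p + ‖b‖ ^ q - ⨍ x in PeriodicCell.cell x₀ v, n₀ x)
            ≤ PeriodicCell.homLagrangian x₀ v p q L a b ∧
        PeriodicCell.homLagrangian x₀ v p q L a b
            ≤ C₁ * (‖a‖ ^ p + ‖b‖ ^ q + ⨍ x in PeriodicCell.cell x₀ v, n₁ x)) := by
  have hP : p.HolderConjugate p' :=
    Real.holderConjugate_iff.2 ⟨hp, by rwa [one_div, one_div] at hpp'⟩
  have hR : q.HolderConjugate q' :=
    Real.holderConjugate_iff.2 ⟨hq, by rwa [one_div, one_div] at hqq'⟩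
  have hf := PeriodicCell.isGrowthIntegrand_of_isLagrangian (p := p) (q := q) hQ hL hC₀ hC₁ hn₀
    hn₁ hbd
  have hconv := PeriodicCell.convexOn_homLagrangian hf hP hR
  have hm := PeriodicCell.volume_real_cell_pos x₀ v
  have hbd' := ae_restrict_of_ae_restrict_of_subset hQ hbd
  have hi₀ := hn₀.mono_set hQ
  have hi₁ := hn₁.mono_set hQ
  refine ⟨fun a b φ G g hG hg => PeriodicCell.integrableOn_lagrangian hf hP hR hG hg,
    fun a b => ?_, hf.ae_bddAbove_conjValues hP hR,
    fun a' b' φ G g hG hg => PeriodicCell.integrableOn_conj hf hP hR hG hg, hconv,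
    hconv.locallyLipschitz.continuous.lowerSemicontinuous,
    fun a' b' => ⟨PeriodicCell.bddAbove_conjValues_homLagrangian hf hP hR a' b',
      (PeriodicCell.isLeast_conj_homLagrangian hf hP hR a' b').isGLB⟩, fun a b => ⟨?_, ?_⟩⟩
  · obtain ⟨φ, G, g, hG, hg, e⟩ := PeriodicCell.exists_homLagrangian_eq hf hP hR a b
    refine ⟨⟨φ, G, g, hG, hg, e⟩, ?_⟩
    rintro _ ⟨φ', G', g', hG', hg', rfl⟩
    exact PeriodicCell.homLagrangian_le hf hP hR hG' hg'
  · obtain ⟨φ, G, g, hG, hg, e⟩ := PeriodicCell.exists_homLagrangian_eq hf hP hR a b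
    -- Lower growth: Jensen's inequality discards the fluctuations of the minimizer.
    have h1 := PeriodicCell.norm_rpow_le_average_const_add hp.le hG.memLp_grad
      (hG.integral_grad_eq_zero hp.le) a
    have h2 := PeriodicCell.norm_rpow_le_average_const_add hq.le hg.memLp hg.mean_zero b
    have i1 := (hG.memLp_const_add a).integrable_rpow_ofReal hP.pos
    have i2 := (hg.memLp_const_add b).integrable_rpow_ofReal hR.pos
    have i3 := PeriodicCell.integrableOn_lagrangian hf hP hR hG hg (a := a) (b := b)
    have hle := integral_mono_ae (((i1.add i2).sub hi₀).const_mul C₀) i3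
      (hbd'.mono fun x hx => (hx (a + G x) (b + g x)).1)
    rw [integral_const_mul, integral_sub' (i1.add i2) hi₀, integral_add' i1 i2] at hle
    rw [e]
    simp only [PeriodicCell.setAverage_eq_inv_mul] at h1 h2 ⊢
    rw [le_inv_mul_iff₀ hm] at h1 h2 ⊢
    refine le_trans ?_ hle
    rw [mul_left_comm]
    refine mul_le_mul_of_nonneg_left ?_ hC₀.le
    rw [mul_sub, mul_add, mul_inv_cancel_left₀ hm.ne']
    linarith
  -- Upper growth: zero fluctuations are admissible.
  · have h1 := PeriodicCell.homLagrangian_le hf hP hR (PeriodicCell.IsPeriodicSobolev.zero x₀ v p)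
      (PeriodicCell.IsPeriodicSolenoidal.zero x₀ v q) (a := a) (b := b)
    refine h1.trans ?_
    have i3 := PeriodicCell.integrableOn_lagrangian hf hP hR
      (PeriodicCell.IsPeriodicSobolev.zero x₀ v p)
      (PeriodicCell.IsPeriodicSolenoidal.zero x₀ v q) (a := a) (b := b)
    simp only [Pi.zero_apply, add_zero] at i3 ⊢
    have ic : IntegrableOn (fun _ : PeriodicCell.Vec N => ‖a‖ ^ p + ‖b‖ ^ q)
      (PeriodicCell.cell x₀ v) := integrable_const _
    have hle := integral_mono_ae i3 ((ic.add hi₁).const_mul C₁)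
      (hbd'.mono fun x hx => (hx a b).2)
    rw [integral_const_mul, integral_add' ic hi₁, setIntegral_const, smul_eq_mul] at hle
    simp only [PeriodicCell.setAverage_eq_inv_mul]
    rw [inv_mul_le_iff₀ hm]
    refine hle.trans (le_of_eq ?_)
    field_simp
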